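/- A right regular band of groups is a regular semigroup (for every $s$ there is $t$ with $sts=s$) in which every right ideal is two-sided. Let $S$ be a finite monoid that is a right regular band of groups, and let $k$ be an algebraically closed field whose characteristic does not divide the order of any maximal subgroup of $S$. All modules are right modules unless stated otherwise. For an idempotent $f\in S$ let $G_f$ be its maximal subgroup, that is, the group of units of the monoid $fSf$, and let $R_f=\{x\in S: xS=fS\}$; the space $kR_f$ is a $kG_f$-$kS$-bimodule, where $G_f$ acts by left multiplication and $s\in S$ sends $x\in R_f$ to $xs$ if $xs\in R_f$ and to $0$ otherwise. For a simple $kG_f$-module $W$ put $\mathrm{Ind}_f(W)=W\otimes_{kG_f}kR_f$ and $\widetilde W=\mathrm{Ind}_f(W)/\mathrm{rad}(\mathrm{Ind}_f(W))$, the simple $kS$-module with apex the $\mathscr J$-class of $f$ that corresponds to $W$. Let $J$ be the minimal ideal of $S$, let $e\in J$ be an idempotent, $H=G_e$, and let $G=G_1$ be the group of units of $S$. Let $\approx$ be the equivalence relation on $J$ generated by the pairs $(x,x')$ such that $xe=x'e$ and there is $w\in S\setminus(G\cup J)$ with $xw=x$ and $x'w=x'$. Put $X=J/{\approx}$. Then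 $H$ acts on $X$ on the left by $h[x]=[hx]$, $G$ acts on $X$ on the right by $[x]g=[xg]$, and $[x]\mapsto xe$ defines a homomorphism $\varepsilon\colon kX\to kH$ of $kH$-$kG$-bimodules, where $g\in G$ acts on $kH$ on the right as multiplication by $ge\in H$. Let $M=\ker\varepsilon$. **Theorem.** Let $U$ be a simple $kH$-module and $V$ a simple $kG$-module, so that $\widetilde U$ has apex $J$ and $\widetilde V$ has apex $G$. Then $\dim_k\mathrm{Ext}^1_{kS}(\widetilde U,\widetilde V)$ is finite and equals the multiplicity of $V$ as a composition factor of the $kG$-module $U\otimes_{kH}M$. -/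

import Mathlib

universe u v w

noncomputable section

namespace RRBG

open MulOpposite
open scoped TensorProduct

/-! ## Semigroups: principal ideals, regularity, right regular bands of groups -/

section Semigroups

variable {S : Type u}

/-- A right regular band of groups: a regular semigroup in which every right ideal is a
two-sided ideal. -/
class IsRRBG (S : Type u) [Semigroup S] : Prop where
  regular : ∀ s : S, ∃ t : S, s * t * s = s
  leftIdeal_of_rightIdeal : ∀ R : Set S,
    (∀ r ∈ R, ∀ s : S, r * s ∈ R) → ∀ r ∈ R, ∀ s : S, s * r ∈ R

/-- The principal right ideal `sS` of an element of a monoid. -/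
def rightIdeal [Monoid S] (s : S) : Set S := {x | ∃ a : S, x = s * a}

/-- The principal two-sided ideal `SsS` of an element of a monoid. -/
def twoSidedIdeal [Monoid S] (s : S) : Set S := {x | ∃ a b : S, x = a * s * b}

/-- Green's preorder `s ≤ t` in the sense of two-sided ideals: `SsS ⊆ StS`. -/
def JLE [Monoid S] (s t : S) : Prop := twoSidedIdeal s ⊆ twoSidedIdeal t

/-- The minimal ideal of a (finite) monoid: the elements lying `J`-below every element. -/
def minimalIdeal (S : Type u) [Monoid S] : Set S := {x | ∀ s : S, JLE x s}

/-- The idempotents `E(S)`. -/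
abbrev Idem (S : Type u) [Mul S] : Type u := {e : S // IsIdempotentElem e}

/-- The identity, as an idempotent. -/
def oneIdem (S : Type u) [Monoid S] : Idem S := ⟨1, IsIdempotentElem.one⟩

/-- The local monoid `eSe` at an idempotent `e`. -/
@[ext] structure LocalMonoid [Monoid S] (e : Idem S) : Type u where
  val : S
  mem : ∃ t : S, val = e.1 * t * e.1

section LocalMonoid

variable [Monoid S] {e : Idem S}

theorem LocalMonoid.left (x : LocalMonoid e) : e.1 * x.val = x.val := by
  obtain ⟨t, ht⟩ := x.mem
  rw [ht, ← mul_assoc, ← mul_assoc, e.2.eq]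

theorem LocalMonoid.right (x : LocalMonoid e) : x.val * e.1 = x.val := by
  obtain ⟨t, ht⟩ := x.mem
  rw [ht, mul_assoc, e.2.eq]

instance : Monoid (LocalMonoid e) where
  mul x y := ⟨x.val * y.val, x.val * y.val, by
    rw [← mul_assoc, x.left, mul_assoc, y.right]⟩
  mul_assoc x y z := LocalMonoid.ext (mul_assoc x.val y.val z.val)
  one := ⟨e.1, e.1, by rw [e.2.eq, e.2.eq]⟩
  one_mul x := LocalMonoid.ext x.left
  mul_one x := LocalMonoid.ext x.right

end LocalMonoid

/-- The maximal subgroup `G_e` of `S` at the idempotent `e`: the group of units of `eSe`.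
For `e = 1` this is the group of units of `S`. -/
abbrev MaxSubgroup [Monoid S] (e : Idem S) : Type u := (LocalMonoid e)ˣ

/-- The element of `S` underlying an element of a maximal subgroup. -/
def MaxSubgroup.toS [Monoid S] {e : Idem S} (g : MaxSubgroup e) : S := g.val.val

section MaxSubgroup

variable [Monoid S] {e : Idem S}

theorem MaxSubgroup.toS_mul (g h : MaxSubgroup e) : (g * h).toS = g.toS * h.toS := rfl

theorem MaxSubgroup.toS_one : (1 : MaxSubgroup e).toS = e.1 := rfl

theorem MaxSubgroup.left (g : MaxSubgroup e) : e.1 * g.toS = g.toS := g.val.left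

theorem MaxSubgroup.right (g : MaxSubgroup e) : g.toS * e.1 = g.toS := g.val.right

theorem MaxSubgroup.mul_inv' (g : MaxSubgroup e) : g.toS * g⁻¹.toS = e.1 := by
  rw [← MaxSubgroup.toS_mul, mul_inv_cancel, MaxSubgroup.toS_one]

theorem MaxSubgroup.inv_mul' (g : MaxSubgroup e) : g⁻¹.toS * g.toS = e.1 := by
  rw [← MaxSubgroup.toS_mul, inv_mul_cancel, MaxSubgroup.toS_one]

theorem MaxSubgroup.toS_injective :
    Function.Injective (MaxSubgroup.toS : MaxSubgroup e → S) :=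
  fun _ _ h => Units.ext (LocalMonoid.ext h)

theorem rightIdeal_subset_iff {s t : S} :
    rightIdeal s ⊆ rightIdeal t ↔ ∃ a, s = t * a := by
  constructor
  · intro h
    exact h ⟨1, (mul_one s).symm⟩
  · rintro ⟨a, rfl⟩ x ⟨b, rfl⟩
    exact ⟨a * b, mul_assoc _ _ _⟩

theorem JLE_iff {s t : S} : JLE s t ↔ ∃ a b, s = a * t * b := by
  constructor
  · intro h
    exact h ⟨1, 1, by simp⟩
  · rintro ⟨a, b, rfl⟩ x ⟨c, d, rfl⟩
    exact ⟨c * a, b * d, by simp only [mul_assoc]⟩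

theorem isUnit_of_inverses {s t : S} (h1 : s * t = 1) (h2 : t * s = 1) : IsUnit s :=
  ⟨⟨s, t, h1, h2⟩, rfl⟩

theorem minimalIdeal_mul_right {x : S} (hx : x ∈ minimalIdeal S) (s : S) :
    x * s ∈ minimalIdeal S := fun t => by
  obtain ⟨a, b, h⟩ := JLE_iff.1 (hx t)
  exact JLE_iff.2 ⟨a, b * s, by rw [← mul_assoc, ← h]⟩

theorem minimalIdeal_mul_left {x : S} (hx : x ∈ minimalIdeal S) (s : S) :
    s * x ∈ minimalIdeal S := fun t => by
  obtain ⟨a, b, h⟩ := JLE_iff.1 (hx t)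
  exact JLE_iff.2 ⟨s * a, b, by rw [mul_assoc s, mul_assoc s, ← h]⟩

end MaxSubgroup

section RRBGLemmas

variable [Monoid S] [IsRRBG S]

theorem IsRRBG.exists_mul (s x : S) : ∃ a, s * x = x * a :=
  IsRRBG.leftIdeal_of_rightIdeal (rightIdeal x)
    (by rintro r ⟨a, rfl⟩ s; exact ⟨a * s, mul_assoc _ _ _⟩) x ⟨1, (mul_one x).symm⟩ s

theorem IsRRBG.idem_mul (e : Idem S) (s : S) : e.1 * (s * e.1) = s * e.1 := by
  obtain ⟨a, ha⟩ := IsRRBG.exists_mul s e.1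
  rw [ha, ← mul_assoc, e.2.eq]

/-- For `e` in the minimal ideal, the product `xe` lies in the maximal
subgroup at `e`. -/
theorem exists_maxSubgroup (e : Idem S) (he : e.1 ∈ minimalIdeal S) (x : S) : ∃ h : MaxSubgroup e, h.toS = x * e.1 := by
  have key : ∀ y : LocalMonoid e, ∃ z : LocalMonoid e, y * z = 1 := by
    intro y
    obtain ⟨a, b, hab⟩ := JLE_iff.1 (he y.val)
    obtain ⟨c, hc⟩ := IsRRBG.exists_mul a y.val
    refine ⟨⟨e.1 * (c * b) * e.1, c * b, rfl⟩, LocalMonoid.ext ?_⟩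
    change y.val * (e.1 * (c * b) * e.1) = e.1
    rw [← mul_assoc, ← mul_assoc, y.right, ← mul_assoc, ← hc, ← hab, e.2.eq]
  have hmem : ∃ t, x * e.1 = e.1 * t * e.1 :=
    ⟨x, by rw [mul_assoc, IsRRBG.idem_mul]⟩
  obtain ⟨z, hz⟩ := key ⟨x * e.1, hmem⟩
  obtain ⟨y, hy⟩ := key z
  have hyx : y = ⟨x * e.1, hmem⟩ := by
    rw [← one_mul y, ← hz, mul_assoc, hy, mul_one]
  rw [hyx] at hy
  exact ⟨⟨⟨x * e.1, hmem⟩, z, hz, hy⟩, rfl⟩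

end RRBGLemmas

end Semigroups

/-! ## Right modules

A right module over a ring `A` is a module over `Aᵐᵒᵖ`. -/

section Modules

variable (k : Type u) [Field k]

/-- The left `kT`-module structure given by a representation of `T` on `W`. -/
abbrev leftModuleOfRep {T : Type v} [Monoid T] {W : Type w} [AddCommGroup W] [Module k W]
    (ρ : T →* Module.End k W) : Module (MonoidAlgebra k T) W :=
  Module.compHom W (MonoidAlgebra.lift k (Module.End k W) T ρ).toRingHom

/-- The right `kT`-module structure given by an anti-representation of `T` on `W`. -/
abbrev rightModuleOfRep {T : Type v} [Monoid T] {W : Type w} [AddCommGroup W] [Module k W]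
    (σ : T →* (Module.End k W)ᵐᵒᵖ) : Module (MonoidAlgebra k T)ᵐᵒᵖ W :=
  Module.compHom W
    (AlgHom.opComm (MonoidAlgebra.lift k (Module.End k W)ᵐᵒᵖ T σ)).toRingHom

/-- The tensor product `U ⊗_B M` of a right `B`-module `U` and a `B`-`A`-bimodule `M` over
`k`-algebras `A` and `B`, as a right `A`-module.  It is the quotient of the tensor product
over `k` (written with the factors interchanged) by the relations `ub ⊗ m = u ⊗ bm`. -/
abbrev BalancedTensor {B : Type*} [Ring B] (A : Type*) [Ring A] [Algebra k A]
    (U : Type*) [AddCommGroup U] [Module k U] [Module Bᵐᵒᵖ U]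
    (M : Type*) [AddCommGroup M] [Module k M] [Module B M] [Module Aᵐᵒᵖ M]
    [IsScalarTower k Aᵐᵒᵖ M] : Type _ :=
  (M ⊗[k] U) ⧸ Submodule.span Aᵐᵒᵖ
    {z : M ⊗[k] U | ∃ (u : U) (b : B) (m : M), z = m ⊗ₜ[k] (op b • u) - (b • m) ⊗ₜ[k] u}

/-- `m` is the multiplicity of `V` as a composition factor of `N`: the module `N` has a
composition series, and every composition series of `N` has exactly `m` factors isomorphic
to `V`. -/
def IsCompositionMultiplicity (R : Type*) [Ring R] (V : Type*) [AddCommGroup V] [Module R V]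
    (N : Type*) [AddCommGroup N] [Module R N] (m : ℕ) : Prop :=
  (∃ s : CompositionSeries (Submodule R N), s.head = ⊥ ∧ s.last = ⊤) ∧
  ∀ s : CompositionSeries (Submodule R N), s.head = ⊥ → s.last = ⊤ →
    Nat.card {i : Fin s.length //
      Nonempty ((s i.succ ⧸ (s i.castSucc).submoduleOf (s i.succ)) ≃ₗ[R] V)} = m

end Modules

/-! ## Induced modules and the simple modules with a given apex -/

section Induced

variable (k : Type u) [Field k] {S : Type u} [Monoid S]

/-- The `R`-class of an idempotent `e`. -/
@[ext] structure RClass (e : Idem S) : Type u where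
  val : S
  mem : rightIdeal val = rightIdeal e.1

theorem RClass.mul_of_mul (e : Idem S) (x : RClass e) (s t : S)
    (h : rightIdeal (x.val * (s * t)) = rightIdeal e.1) :
    rightIdeal (x.val * s) = rightIdeal e.1 := by
  apply subset_antisymm
  · exact (rightIdeal_subset_iff.2 ⟨s, rfl⟩).trans x.mem.subset
  · exact h.symm.subset.trans (rightIdeal_subset_iff.2 ⟨t, (mul_assoc _ _ _).symm⟩)

theorem RClass.maxSubgroup_mul (e : Idem S) (g : MaxSubgroup e) (x : RClass e) :
    rightIdeal (g.toS * x.val) = rightIdeal e.1 := by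
  obtain ⟨a, ha⟩ := rightIdeal_subset_iff.1 x.mem.symm.subset
  apply subset_antisymm
  · exact rightIdeal_subset_iff.2 ⟨g.toS * x.val, by rw [← mul_assoc, g.left]⟩
  · refine rightIdeal_subset_iff.2 ⟨a * g⁻¹.toS, ?_⟩
    rw [mul_assoc, ← mul_assoc x.val, ← ha, ← mul_assoc, g.right, g.mul_inv']

/-- The vector space `kR` with basis the `R`-class `R` of the idempotent `e`. -/
abbrev KR (e : Idem S) : Type u := RClass e →₀ k


open Classical in
/-- The effect of `s ∈ S` on a basis vector `x` of `kR`: it is `xs` if `xs ∈ R`, and `0`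
otherwise. -/
def KR.act (e : Idem S) (s : S) (x : RClass e) : KR k e :=
  if h : rightIdeal (x.val * s) = rightIdeal e.1 then Finsupp.single ⟨x.val * s, h⟩ 1 else 0

/-- The right Schützenberger representation of `S` on `kR`. -/
def KR.rightRep (e : Idem S) : S →* (Module.End k (KR k e))ᵐᵒᵖ where
  toFun s := op (Finsupp.linearCombination k (KR.act k e s))
  map_one' := by
    apply unop_injective
    refine Finsupp.lhom_ext' fun x => LinearMap.ext_ring ?_
    have h : rightIdeal (x.val * 1) = rightIdeal e.1 := by rw [mul_one]; exact x.mem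
    change Finsupp.linearCombination k (KR.act k e 1) (Finsupp.single x 1) = Finsupp.single x 1
    rw [Finsupp.linearCombination_single, one_smul, KR.act, dif_pos h]
    congr 1
    exact RClass.ext (mul_one x.val)
  map_mul' s t := by
    apply unop_injective
    refine Finsupp.lhom_ext' fun x => LinearMap.ext_ring ?_
    change Finsupp.linearCombination k (KR.act k e (s * t)) (Finsupp.single x 1) =
      Finsupp.linearCombination k (KR.act k e t)
        (Finsupp.linearCombination k (KR.act k e s) (Finsupp.single x 1))
    rw [Finsupp.linearCombination_single, Finsupp.linearCombination_single, one_smul, one_smul]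
    by_cases hs : rightIdeal (x.val * s) = rightIdeal e.1
    · rw [show KR.act k e s x = Finsupp.single ⟨x.val * s, hs⟩ 1 from dif_pos hs]
      rw [Finsupp.linearCombination_single, one_smul]
      simp only [KR.act, mul_assoc]
    · have hst : ¬ rightIdeal (x.val * (s * t)) = rightIdeal e.1 :=
        fun h => hs (RClass.mul_of_mul e x s t h)
      rw [show KR.act k e s x = 0 from dif_neg hs, map_zero]
      exact dif_neg hst

/-- The action of the maximal subgroup `G_e` on `kR` by left multiplication. -/
def KR.leftRep (e : Idem S) : MaxSubgroup e →* Module.End k (KR k e) where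
  toFun g := Finsupp.lmapDomain k k
    (fun x : RClass e => (⟨g.toS * x.val, RClass.maxSubgroup_mul e g x⟩ : RClass e))
  map_one' := by
    refine Finsupp.lhom_ext' fun x => LinearMap.ext_ring ?_
    change Finsupp.mapDomain _ (Finsupp.single x 1) = Finsupp.single x 1
    rw [Finsupp.mapDomain_single]
    congr 1
    obtain ⟨a, ha⟩ := rightIdeal_subset_iff.1 x.mem.subset
    refine RClass.ext ?_
    change e.1 * x.val = x.val
    rw [ha, ← mul_assoc, e.2.eq]
  map_mul' g h := by
    refine Finsupp.lhom_ext' fun x => LinearMap.ext_ring ?_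
    change Finsupp.mapDomain _ (Finsupp.single x 1) =
      Finsupp.mapDomain _ (Finsupp.mapDomain _ (Finsupp.single x 1))
    simp only [Finsupp.mapDomain_single, MaxSubgroup.toS_mul, mul_assoc]

/-- `kR` as a left `kG_e`-module. -/
instance (e : Idem S) : Module (MonoidAlgebra k (MaxSubgroup e)) (KR k e) :=
  leftModuleOfRep k (KR.leftRep k e)

/-- `kR` as a right `kS`-module. -/
instance (e : Idem S) : Module (MonoidAlgebra k S)ᵐᵒᵖ (KR k e) :=
  rightModuleOfRep k (KR.rightRep k e)

instance (e : Idem S) : IsScalarTower k (MonoidAlgebra k S)ᵐᵒᵖ (KR k e) where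
  smul_assoc c a x := by
    change AlgHom.opComm (MonoidAlgebra.lift k _ S (KR.rightRep k e)) (c • a) x =
      c • AlgHom.opComm (MonoidAlgebra.lift k _ S (KR.rightRep k e)) a x
    rw [map_smul, LinearMap.smul_apply]

/-- The induced right `kS`-module `Ind(V) = V ⊗_{kG_e} kR` of a right `kG_e`-module `V`. -/
abbrev Ind (e : Idem S) (V : Type u) [AddCommGroup V] [Module k V]
    [Module (MonoidAlgebra k (MaxSubgroup e))ᵐᵒᵖ V] : Type u :=
  BalancedTensor k (B := MonoidAlgebra k (MaxSubgroup e)) (MonoidAlgebra k S) V (KR k e)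

/-- The right `kS`-module `Ṽ = Ind(V) / rad(Ind(V))`; for `V` simple it is the simple
`kS`-module with apex the `J`-class of `e` corresponding to `V`. -/
abbrev Tilde (e : Idem S) (V : Type u) [AddCommGroup V] [Module k V]
    [Module (MonoidAlgebra k (MaxSubgroup e))ᵐᵒᵖ V] : Type u :=
  Ind k e V ⧸ Module.jacobson (MonoidAlgebra k S)ᵐᵒᵖ (Ind k e V)

end Induced

/-! ## The bimodule `M` -/

section Bimodule

variable {S : Type u} [Monoid S]

/-- The idempotents of the minimal ideal. -/
abbrev MinIdem (S : Type u) [Monoid S] : Type u := {e : Idem S // e.1 ∈ minimalIdeal S}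

/-- The relation `x ⌣ x'` on the minimal ideal `J`: `xe = x'e`, and there is a non-unit `w`
outside `J` with `xw = x` and `x'w = x'`. -/
def Smile (e : MinIdem S) (x x' : minimalIdeal S) : Prop :=
  x.1 * e.1.1 = x'.1 * e.1.1 ∧
    ∃ w : S, ¬ IsUnit w ∧ w ∉ minimalIdeal S ∧ x.1 * w = x.1 ∧ x'.1 * w = x'.1

/-- The equivalence relation `≈` on the minimal ideal generated by `⌣`. -/
def approx (e : MinIdem S) : Setoid (minimalIdeal S) := Relation.EqvGen.setoid (Smile e)

/-- The set `X = J/≈`. -/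
abbrev X (e : MinIdem S) : Type u := Quotient (approx e)

theorem approx_map (e : MinIdem S) (f : minimalIdeal S → minimalIdeal S)
    (hf : ∀ x y, Smile e x y → Smile e (f x) (f y)) (x y : minimalIdeal S)
    (h : (approx e).r x y) : (approx e).r (f x) (f y) := by
  change Relation.EqvGen (Smile e) x y at h
  change Relation.EqvGen (Smile e) (f x) (f y)
  induction h with
  | rel x y h => exact .rel _ _ (hf x y h)
  | refl x => exact .refl _
  | symm x y _ ih => exact .symm _ _ ih
  | trans x y z _ _ h1 h2 => exact .trans _ _ _ h1 h2

theorem approx_mul_eq (e : MinIdem S) (x y : minimalIdeal S) (h : (approx e).r x y) :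
    x.1 * e.1.1 = y.1 * e.1.1 := by
  change Relation.EqvGen (Smile e) x y at h
  induction h with
  | rel x y h => exact h.1
  | refl x => rfl
  | symm x y _ ih => exact ih.symm
  | trans x y z _ _ h1 h2 => exact h1.trans h2

theorem minIdem_mul [IsRRBG S] (e : MinIdem S) (x : minimalIdeal S) :
    e.1.1 * x.1 = x.1 := by
  obtain ⟨a, b, hab⟩ := JLE_iff.1 (x.2 e.1.1)
  rw [hab, ← mul_assoc, IsRRBG.idem_mul]

/-- The left action `h[x] = [hx]` of the maximal subgroup `H` at `e` on `X`. -/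
def X.left (e : MinIdem S) (h : MaxSubgroup e.1) : X e → X e :=
  Quotient.map (fun x => ⟨h.toS * x.1, minimalIdeal_mul_left x.2 _⟩)
    (approx_map e _ (by
      rintro x y ⟨hxy, w, hw, hwJ, hx, hy⟩
      exact ⟨by simp only [mul_assoc, hxy], w, hw, hwJ,
        by simp only [mul_assoc, hx], by simp only [mul_assoc, hy]⟩))

/-- The right action `[x]g = [xg]` of the group of units `G` on `X`. -/
def X.right [IsRRBG S] (e : MinIdem S) (g : MaxSubgroup (oneIdem S)) : X e → X e :=
  Quotient.map (fun x => ⟨x.1 * g.toS, minimalIdeal_mul_right x.2 _⟩)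
    (approx_map e _ (by
      rintro x y ⟨hxy, w, hw, hwJ, hx, hy⟩
      have h1 : g.toS * g⁻¹.toS = 1 := g.mul_inv'
      have h2 : g⁻¹.toS * g.toS = 1 := g.inv_mul'
      have hconj : g.toS * (g⁻¹.toS * w * g.toS) * g⁻¹.toS = w := by
        calc _ = (g.toS * g⁻¹.toS) * w * (g.toS * g⁻¹.toS) := by simp only [mul_assoc]
          _ = w := by rw [h1, one_mul, mul_one]
      have hfix : ∀ z : S, z * w = z → z * g.toS * (g⁻¹.toS * w * g.toS) = z * g.toS := by
        intro z hz
        calc _ = z * (g.toS * g⁻¹.toS) * w * g.toS := by simp only [mul_assoc]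
          _ = z * g.toS := by rw [h1, mul_one, hz]
      refine ⟨?_, g⁻¹.toS * w * g.toS, fun hu => hw ?_, fun hJ => hwJ ?_, hfix _ hx, hfix _ hy⟩
      · change x.1 * g.toS * e.1.1 = y.1 * g.toS * e.1.1
        rw [mul_assoc, mul_assoc, ← IsRRBG.idem_mul, ← mul_assoc, ← mul_assoc y.1, hxy]
      · rw [← hconj]
        exact ((isUnit_of_inverses h1 h2).mul hu).mul (isUnit_of_inverses h2 h1)
      · rw [← hconj]
        exact minimalIdeal_mul_right (minimalIdeal_mul_left hJ _) _))

/-- The map `X → H`, `[x] ↦ xe`. -/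
def X.toH [IsRRBG S] (e : MinIdem S) : X e → MaxSubgroup e.1 :=
  Quotient.lift (fun x => (exists_maxSubgroup e.1 e.2 x.1).choose) (by
    intro x y h
    apply MaxSubgroup.toS_injective
    rw [(exists_maxSubgroup e.1 e.2 x.1).choose_spec,
      (exists_maxSubgroup e.1 e.2 y.1).choose_spec]
    exact approx_mul_eq e x y h)

theorem X.toH_mk [IsRRBG S] (e : MinIdem S) (x : minimalIdeal S) :
    (X.toH e ⟦x⟧).toS = x.1 * e.1.1 :=
  (exists_maxSubgroup e.1 e.2 x.1).choose_spec

variable [IsRRBG S] (k : Type u) [Field k]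

/-- The vector space `kX` with basis `X`. -/
abbrev KX (e : MinIdem S) : Type u := X e →₀ k

/-- The left representation of `H` on `kX`. -/
def KX.leftRep (e : MinIdem S) : MaxSubgroup e.1 →* Module.End k (KX k e) where
  toFun h := Finsupp.lmapDomain k k (X.left e h)
  map_one' := by
    have h : X.left e 1 = id := by
      funext x
      induction x using Quotient.inductionOn with | _ x => ?_
      exact congrArg (fun y => (⟦y⟧ : X e)) (Subtype.ext (minIdem_mul e x))
    rw [h, Finsupp.lmapDomain_id]
    rfl
  map_mul' g h := by
    have h : X.left e (g * h) = X.left e g ∘ X.left e h := by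
      funext x
      induction x using Quotient.inductionOn with | _ x => ?_
      exact congrArg (fun y => (⟦y⟧ : X e)) (Subtype.ext (mul_assoc _ _ _))
    rw [h, Finsupp.lmapDomain_comp]
    rfl

/-- The right representation of `G` on `kX`. -/
def KX.rightRep (e : MinIdem S) :
    MaxSubgroup (oneIdem S) →* (Module.End k (KX k e))ᵐᵒᵖ where
  toFun g := op (Finsupp.lmapDomain k k (X.right e g))
  map_one' := by
    have h : X.right e 1 = id := by
      funext x
      induction x using Quotient.inductionOn with | _ x => ?_
      exact congrArg (fun y => (⟦y⟧ : X e)) (Subtype.ext (mul_one _))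
    rw [h, Finsupp.lmapDomain_id]
    rfl
  map_mul' g h := by
    have h : X.right e (g * h) = X.right e h ∘ X.right e g := by
      funext x
      induction x using Quotient.inductionOn with | _ x => ?_
      exact congrArg (fun y => (⟦y⟧ : X e)) (Subtype.ext (mul_assoc _ _ _).symm)
    rw [h, Finsupp.lmapDomain_comp]
    rfl

/-- `kX` as a left `kH`-module. -/
instance (e : MinIdem S) : Module (MonoidAlgebra k (MaxSubgroup e.1)) (KX k e) :=
  leftModuleOfRep k (KX.leftRep k e)

/-- `kX` as a right `kG`-module. -/
instance (e : MinIdem S) : Module (MonoidAlgebra k (MaxSubgroup (oneIdem S)))ᵐᵒᵖ (KX k e) :=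
  rightModuleOfRep k (KX.rightRep k e)

/-- The linear map `ε : kX → kH` with `[x] ↦ xe`. -/
def eps (e : MinIdem S) : KX k e →ₗ[k] MonoidAlgebra k (MaxSubgroup e.1) :=
  Finsupp.linearCombination k (fun x => MonoidAlgebra.single (X.toH e x) 1)

theorem eps_single (e : MinIdem S) (x : X e) (c : k) :
    eps k e (Finsupp.single x c) = MonoidAlgebra.single (X.toH e x) c := by
  rw [eps, Finsupp.linearCombination_single, MonoidAlgebra.smul_single, smul_eq_mul, mul_one]

theorem X.toH_left (e : MinIdem S) (h : MaxSubgroup e.1) (x : X e) :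
    X.toH e (X.left e h x) = h * X.toH e x := by
  induction x using Quotient.inductionOn with | _ x => ?_
  apply MaxSubgroup.toS_injective
  rw [MaxSubgroup.toS_mul, X.toH_mk, ← mul_assoc]
  exact X.toH_mk e ⟨h.toS * x.1, _⟩

/-- The homomorphism `ψ : G → H`, `g ↦ ge`, as a map. -/
def psi (e : MinIdem S) (g : MaxSubgroup (oneIdem S)) : MaxSubgroup e.1 :=
  (exists_maxSubgroup e.1 e.2 g.toS).choose

theorem psi_toS (e : MinIdem S) (g : MaxSubgroup (oneIdem S)) :
    (psi e g).toS = g.toS * e.1.1 :=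
  (exists_maxSubgroup e.1 e.2 g.toS).choose_spec

theorem X.toH_right (e : MinIdem S) (g : MaxSubgroup (oneIdem S)) (x : X e) :
    X.toH e (X.right e g x) = X.toH e x * psi e g := by
  induction x using Quotient.inductionOn with | _ x => ?_
  apply MaxSubgroup.toS_injective
  rw [MaxSubgroup.toS_mul, X.toH_mk, psi_toS, mul_assoc x.1, IsRRBG.idem_mul, ← mul_assoc]
  exact X.toH_mk e ⟨x.1 * g.toS, _⟩

theorem KX.single_smul (e : MinIdem S) (h : MaxSubgroup e.1) (c d : k) (x : X e) :
    (MonoidAlgebra.single h c : MonoidAlgebra k (MaxSubgroup e.1)) •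
      (Finsupp.single x d : KX k e) = Finsupp.single (X.left e h x) (c * d) := by
  change MonoidAlgebra.lift k _ _ (KX.leftRep k e) (MonoidAlgebra.single h c)
    (Finsupp.single x d) = _
  rw [MonoidAlgebra.lift_single, LinearMap.smul_apply]
  change c • Finsupp.mapDomain _ (Finsupp.single x d) = _
  rw [Finsupp.mapDomain_single, Finsupp.smul_single, smul_eq_mul]

theorem KX.op_single_smul (e : MinIdem S) (g : MaxSubgroup (oneIdem S)) (c d : k) (x : X e) :
    op (MonoidAlgebra.single g c : MonoidAlgebra k (MaxSubgroup (oneIdem S))) •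
      (Finsupp.single x d : KX k e) = Finsupp.single (X.right e g x) (c * d) := by
  change (MonoidAlgebra.lift k _ _ (KX.rightRep k e) (MonoidAlgebra.single g c)).unop
    (Finsupp.single x d) = _
  rw [MonoidAlgebra.lift_single, unop_smul, LinearMap.smul_apply]
  change c • Finsupp.mapDomain _ (Finsupp.single x d) = _
  rw [Finsupp.mapDomain_single, Finsupp.smul_single, smul_eq_mul]

/-- `ε` is a homomorphism of left `kH`-modules. -/
theorem eps_left (e : MinIdem S) (a : MonoidAlgebra k (MaxSubgroup e.1)) (m : KX k e) :
    eps k e (a • m) = a * eps k e m := by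
  induction m using Finsupp.induction_linear with
  | zero => rw [smul_zero, map_zero, mul_zero]
  | add m n hm hn => rw [smul_add, map_add, map_add, hm, hn, mul_add]
  | single x d =>
    induction a using MonoidAlgebra.induction_linear with
    | zero => rw [zero_smul, map_zero, zero_mul]
    | add a b ha hb => rw [add_smul, map_add, ha, hb, add_mul]
    | single h c =>
      rw [KX.single_smul, eps_single, eps_single, MonoidAlgebra.single_mul_single, X.toH_left]

/-- `ε` is a homomorphism of right `kG`-modules, where `G` acts on `kH` through `g ↦ ge`. -/
theorem eps_right (e : MinIdem S) (a : MonoidAlgebra k (MaxSubgroup (oneIdem S)))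
    (m : KX k e) :
    eps k e (op a • m) = eps k e m * MonoidAlgebra.mapDomain (psi e) a := by
  induction m using Finsupp.induction_linear with
  | zero => rw [smul_zero, map_zero, zero_mul]
  | add m n hm hn => rw [smul_add, map_add, map_add, hm, hn, add_mul]
  | single x d =>
    induction a using MonoidAlgebra.induction_linear with
    | zero => rw [op_zero, zero_smul, map_zero, MonoidAlgebra.mapDomain_zero, mul_zero]
    | add a b ha hb =>
      rw [op_add, add_smul, map_add, ha, hb, MonoidAlgebra.mapDomain_add, mul_add]
    | single g c =>
      rw [KX.op_single_smul, eps_single, eps_single, MonoidAlgebra.mapDomain_single,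
        MonoidAlgebra.single_mul_single, X.toH_right, mul_comm c d]

/-- The `kH`-`kG`-bimodule `M`, the kernel of `ε : kX → kH`. -/
abbrev BimodM (e : MinIdem S) : Type u := LinearMap.ker (eps k e)

instance (e : MinIdem S) : SMul (MonoidAlgebra k (MaxSubgroup e.1)) (BimodM k e) where
  smul a m := ⟨a • (m : KX k e), by
    rw [LinearMap.mem_ker, eps_left, LinearMap.mem_ker.1 m.2, mul_zero]⟩

instance (e : MinIdem S) :
    SMul (MonoidAlgebra k (MaxSubgroup (oneIdem S)))ᵐᵒᵖ (BimodM k e) where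
  smul a m := ⟨a • (m : KX k e), by
    rw [LinearMap.mem_ker, ← op_unop a, eps_right, LinearMap.mem_ker.1 m.2, zero_mul]⟩

/-- `M` as a left `kH`-submodule of `kX`. -/
instance (e : MinIdem S) : Module (MonoidAlgebra k (MaxSubgroup e.1)) (BimodM k e) :=
  Function.Injective.module _ (LinearMap.ker (eps k e)).subtype.toAddMonoidHom
    Subtype.val_injective (fun _ _ => rfl)

/-- `M` as a right `kG`-submodule of `kX`. -/
instance (e : MinIdem S) :
    Module (MonoidAlgebra k (MaxSubgroup (oneIdem S)))ᵐᵒᵖ (BimodM k e) :=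
  Function.Injective.module _ (LinearMap.ker (eps k e)).subtype.toAddMonoidHom
    Subtype.val_injective (fun _ _ => rfl)

instance (e : MinIdem S) :
    IsScalarTower k (MonoidAlgebra k (MaxSubgroup (oneIdem S)))ᵐᵒᵖ (BimodM k e) where
  smul_assoc c a x := by
    apply Subtype.ext
    change AlgHom.opComm (MonoidAlgebra.lift k _ _ (KX.rightRep k e)) (c • a) x.1 =
      c • AlgHom.opComm (MonoidAlgebra.lift k _ _ (KX.rightRep k e)) a x.1
    rw [map_smul, LinearMap.smul_apply]

end Bimodule

end RRBG

end

/-!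
The kernel of `t ↦ te` on `Ind_e(U)` is its radical, and `Ind_e(U)` is projective: since `J` is a
single `R`-class, a homomorphism out of `Ind_e(U)` is a `kH`-homomorphism out of `U`, and these
can be averaged over `H`.  Dimension shifting identifies `Ext¹(Ũ, Ṽ)` with
`Hom_{kS}(rad Ind_e(U), Ṽ)`.

Non-units act on `Ṽ` by zero.  Hence a homomorphism from the radical to `Ṽ`, composed with
`t ↦ t - te`, is a family of functions on `J` with values in `V` that are constant on the classes
of `≈`, and `u ⊗ x ↦ u ⊗ ([x] - [xe])` turns it into a `kG`-homomorphism `U ⊗_{kH} M → V`.  As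
`kG` is semisimple and `k` is algebraically closed, the dimension of the space of these counts the
composition factors isomorphic to `V`.
-/

noncomputable section

namespace RRBG

open MulOpposite
open scoped TensorProduct

/-! ## Dimension shifting and composition multiplicities -/

section DimensionShift

open CategoryTheory Abelian

theorem bijective_precomp_extClass {C : Type u} [Category.{v} C] [Abelian C] [HasExt.{w} C]
    {E : ShortComplex C} (hE : E.ShortExact) [Projective E.X₂] {Y : C}
    (hY : ∀ f : E.X₂ ⟶ Y, E.f ≫ f = 0) :
    Function.Bijective (hE.extClass.precomp Y (add_zero 1)) := by
  constructor
  · refine (injective_iff_map_eq_zero _).2 fun x hx => ?_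
    obtain ⟨y, rfl⟩ := Ext.contravariant_sequence_exact₁ hE Y x (add_zero 1) hx
    obtain ⟨f, rfl⟩ := (Ext.mk₀_bijective _ _).2 y
    rw [Ext.mk₀_comp_mk₀, hY, Ext.mk₀_zero]
  · exact fun x => Ext.contravariant_sequence_exact₃ hE Y x
      (Ext.eq_zero_of_projective _) (add_zero 1)

variable (k : Type*) [Field k] {A : Type u} [Ring A] [Algebra k A]
  {P N : Type v} [AddCommGroup P] [Module A P]
  [AddCommGroup N] [Module k N] [Module A N] [IsScalarTower k A N]

/-- The identification of `Hom(P, N)` with `Ext⁰(P, N)`, linear for the given `k`-structure of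
`N`: the one on `Ext` is obtained from `N` by restriction of scalars along `k → A`. -/
def extZeroLinearEquiv [Small.{v} A] :
    (P →ₗ[A] N) ≃ₗ[k] Ext (ModuleCat.of A P) (ModuleCat.of A N) 0 where
  __ := ModuleCat.homAddEquiv.symm.trans Ext.addEquiv₀.symm
  map_smul' c f := by
    refine .trans (congrArg Ext.mk₀ ?_) (Ext.mk₀_smul c (ModuleCat.ofHom f))
    ext x
    exact (algebraMap_smul A c (f x)).symm

theorem rank_ext_one_quotient [Small.{v} A] [Module.Projective A P] (K : Submodule A P)
    (hK : ∀ f : P →ₗ[A] N, K ≤ LinearMap.ker f) :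
    Module.rank k (Ext (ModuleCat.of A (P ⧸ K)) (ModuleCat.of A N) 1) =
      Module.rank k (K →ₗ[A] N) := by
  let E := ShortComplex.moduleCatMk K.subtype K.mkQ
    (LinearMap.exact_subtype_mkQ K).linearMap_comp_eq_zero
  have hE : E.ShortExact := ModuleCat.shortComplex_shortExact _
    (LinearMap.exact_subtype_mkQ K) K.injective_subtype K.mkQ_surjective
  have : Projective E.X₂ := (IsProjective.iff_projective P).1 inferInstance
  have hδ := bijective_precomp_extClass hE (Y := ModuleCat.of A N) fun f => by
    ext x
    exact hK f.hom x.2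
  let δ := LinearEquiv.ofBijective
    (hE.extClass.precompOfLinear k (ModuleCat.of A N) (add_zero 1)) hδ
  exact ((extZeroLinearEquiv k).trans δ).rank_eq.symm

end DimensionShift

section Multiplicity

variable {k : Type*} [Field k] {R : Type*} [Ring R] [Algebra k R]
  {V : Type*} [AddCommGroup V] [Module k V] [Module R V] [IsScalarTower k R V]
  {N : Type*} [AddCommGroup N] [Module k N] [Module R N] [IsScalarTower k R N]

theorem finiteDimensional_linearMap [FiniteDimensional k N] [FiniteDimensional k V] :
    FiniteDimensional k (N →ₗ[R] V) :=
  .of_injective (LinearMap.restrictScalarsₗ k R N V k) (LinearMap.restrictScalars_injective k)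

variable [FiniteDimensional k V]

theorem finrank_linearMap_eq_add [IsSemisimpleModule R N] [FiniteDimensional k N]
    (A : Submodule R N) :
    Module.finrank k (N →ₗ[R] V) =
      Module.finrank k (A →ₗ[R] V) + Module.finrank k ((N ⧸ A) →ₗ[R] V) := by
  obtain ⟨B, hB⟩ := exists_isCompl A
  have (C : Submodule R N) : FiniteDimensional k (C →ₗ[R] V) :=
    have : FiniteDimensional k C := inferInstanceAs (FiniteDimensional k (C.restrictScalars k))
    finiteDimensional_linearMap
  rw [← (LinearEquiv.congrLeft V k (A.prodEquivOfIsCompl B hB)).finrank_eq,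
    ← (LinearMap.coprodEquiv k (R := R) (M := A) (M₂ := B) (M₃ := V)).finrank_eq,
    Module.finrank_prod, (LinearEquiv.congrLeft V k (A.quotientEquivOfIsCompl B hB)).finrank_eq]

theorem eq_add_sum_of_succ_eq_add {M : Type*} [AddCommMonoid M] {n : ℕ} {a : Fin (n + 1) → M}
    {c : Fin n → M} (h : ∀ i : Fin n, a i.succ = a i.castSucc + c i) :
    a (Fin.last n) = a 0 + ∑ i, c i := by
  induction n with
  | zero => rw [Finset.univ_eq_empty, Finset.sum_empty, add_zero, Fin.last_zero]
  | succ n ih =>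
    have hcast : a (Fin.last n).castSucc = a 0 + ∑ i : Fin n, c i.castSucc :=
      ih (a := fun i => a i.castSucc) fun i => h i.castSucc
    rw [← Fin.succ_last, h, hcast, Fin.sum_univ_castSucc, add_assoc]

theorem finrank_linearMap_eq_sum [IsSemisimpleModule R N] [FiniteDimensional k N]
    (s : CompositionSeries (Submodule R N)) (hbot : s.head = ⊥) (htop : s.last = ⊤) :
    Module.finrank k (N →ₗ[R] V) =
      ∑ i : Fin s.length, Module.finrank k
        ((s i.succ ⧸ (s i.castSucc).submoduleOf (s i.succ)) →ₗ[R] V) := by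
  have hstep (i : Fin s.length) : Module.finrank k (s i.succ →ₗ[R] V) =
      Module.finrank k (s i.castSucc →ₗ[R] V) + Module.finrank k
        ((s i.succ ⧸ (s i.castSucc).submoduleOf (s i.succ)) →ₗ[R] V) := by
    have : FiniteDimensional k (s i.succ) :=
      inferInstanceAs (FiniteDimensional k ((s i.succ).restrictScalars k))
    rw [finrank_linearMap_eq_add ((s i.castSucc).submoduleOf (s i.succ)),
      (LinearEquiv.congrLeft V k (Submodule.submoduleOfEquivOfLe (s.step i).le)).finrank_eq]
  have hzero : Module.finrank k (s.head →ₗ[R] V) = 0 := by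
    rw [hbot]
    exact Module.finrank_zero_of_subsingleton
  have hlast : Module.finrank k (s.last →ₗ[R] V) = Module.finrank k (N →ₗ[R] V) := by
    rw [htop]
    exact (LinearEquiv.congrLeft V k Submodule.topEquiv).finrank_eq
  rw [← hlast, ← zero_add (∑ i, _), ← hzero]
  exact eq_add_sum_of_succ_eq_add (a := fun i => Module.finrank k (s i →ₗ[R] V)) hstep

variable [IsAlgClosed k] [IsSimpleModule R V]

open Classical in
theorem finrank_linearMap_of_isSimpleModule {L : Type*} [AddCommGroup L] [Module R L]
    [IsSimpleModule R L] :
    Module.finrank k (L →ₗ[R] V) = if Nonempty (L ≃ₗ[R] V) then 1 else 0 := by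
  split_ifs with h
  · obtain ⟨f⟩ := h
    rw [(LinearEquiv.congrLeft V k f).finrank_eq, ← Module.finrank_self k]
    exact (LinearEquiv.ofBijective (Algebra.linearMap k (Module.End R V))
      (IsSimpleModule.algebraMap_end_bijective_of_isAlgClosed k)).finrank_eq.symm
  · have (f : L →ₗ[R] V) : f = 0 := f.bijective_or_eq_zero.resolve_left fun hf =>
      h ⟨.ofBijective f hf⟩
    have := subsingleton_of_forall_eq 0 this
    exact Module.finrank_zero_of_subsingleton

theorem isCompositionMultiplicity_finrank_linearMap [IsSemisimpleModule R N]
    [FiniteDimensional k N] :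
    IsCompositionMultiplicity R V N (Module.finrank k (N →ₗ[R] V)) := by
  classical
  refine ⟨?_, fun s hbot htop => ?_⟩
  · have : IsNoetherian R N := isNoetherian_of_tower k inferInstance
    have : IsArtinian R N := isArtinian_of_tower k inferInstance
    exact isFiniteLength_iff_exists_compositionSeries.1
      (isFiniteLength_iff_isNoetherian_isArtinian.2 ⟨inferInstance, inferInstance⟩)
  · have (i : Fin s.length) :
        IsSimpleModule R (s i.succ ⧸ (s i.castSucc).submoduleOf (s i.succ)) :=
      (covBy_iff_quot_is_simple (s.step i).le).1 (s.step i)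
    rw [Nat.card_eq_fintype_card, Fintype.card_subtype, Finset.card_filter,
      finrank_linearMap_eq_sum s hbot htop]
    simp only [finrank_linearMap_of_isSimpleModule]

end Multiplicity

/-! ## Right modules over monoid algebras and balanced tensor products -/

section RightAct

variable (k : Type*) [CommSemiring k] {S : Type*} [Monoid S]
  {T : Type*} [AddCommMonoid T] [Module k T] [Module (MonoidAlgebra k S)ᵐᵒᵖ T]
  [IsScalarTower k (MonoidAlgebra k S)ᵐᵒᵖ T]
  {W : Type*} [AddCommMonoid W] [Module k W] [Module (MonoidAlgebra k S)ᵐᵒᵖ W]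
  [IsScalarTower k (MonoidAlgebra k S)ᵐᵒᵖ W]

/-- The action `t ↦ ts` of `s ∈ S` on a right `kS`-module. -/
def rightAct (s : S) : T →ₗ[k] T :=
  Algebra.lsmul k k T (op (MonoidAlgebra.single s (1 : k)))

theorem rightAct_apply (s : S) (t : T) :
    rightAct k s t = op (MonoidAlgebra.single s (1 : k)) • t := rfl

theorem rightAct_one (t : T) : rightAct k (1 : S) t = t := by
  rw [rightAct_apply, ← MonoidAlgebra.one_def, op_one, one_smul]

theorem rightAct_mul (s s' : S) (t : T) :
    rightAct k (s * s') t = rightAct k s' (rightAct k s t) := by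
  simp only [rightAct_apply, smul_smul, ← op_mul, MonoidAlgebra.single_mul_single, mul_one]

theorem op_single_smul (s : S) (c : k) (t : T) :
    op (MonoidAlgebra.single s c) • t = c • rightAct k s t := by
  rw [rightAct_apply, ← smul_assoc, ← op_smul, MonoidAlgebra.smul_single, smul_eq_mul, mul_one]

theorem map_rightAct (f : T →ₗ[(MonoidAlgebra k S)ᵐᵒᵖ] W) (s : S) (t : T) :
    f (rightAct k s t) = rightAct k s (f t) :=
  f.map_smul _ t

theorem coe_rightAct (N : Submodule (MonoidAlgebra k S)ᵐᵒᵖ T) (s : S) (t : N) :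
    ((rightAct k s t : N) : T) = rightAct k s (t : T) :=
  rfl

variable {k}

/-- A `k`-linear map commuting with the action of `S`, as a `kS`-linear map. -/
def linearMapOfRightAct (f : T →ₗ[k] W)
    (hf : ∀ (s : S) t, f (rightAct k s t) = rightAct k s (f t)) :
    T →ₗ[(MonoidAlgebra k S)ᵐᵒᵖ] W where
  toFun := f
  map_add' := f.map_add
  map_smul' a t := by
    induction a using MulOpposite.rec' with | _ a => ?_
    induction a using MonoidAlgebra.induction_linear with
    | zero => simp only [op_zero, zero_smul, map_zero]
    | add a b ha hb =>
      simp only [RingHom.id_apply] at ha hb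
      simp only [op_add, add_smul, map_add, ha, hb, RingHom.id_apply]
    | single s c => rw [op_single_smul, map_smul, hf, RingHom.id_apply, op_single_smul]

/-- A subspace stable under the action of `S`, as a `kS`-submodule. -/
def submoduleOfRightAct (N : Submodule k T) (hN : ∀ (s : S), ∀ t ∈ N, rightAct k s t ∈ N) :
    Submodule (MonoidAlgebra k S)ᵐᵒᵖ T where
  carrier := N
  add_mem' := N.add_mem
  zero_mem' := N.zero_mem
  smul_mem' a t ht := by
    induction a using MulOpposite.rec' with | _ a => ?_
    induction a using MonoidAlgebra.induction_linear with
    | zero => rw [op_zero, zero_smul]; exact N.zero_mem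
    | add a b ha hb => rw [op_add, add_smul]; exact N.add_mem ha hb
    | single s c => rw [op_single_smul]; exact N.smul_mem c (hN s t ht)

end RightAct

section Bimodule

variable {k : Type*} {H S M : Type*} [Monoid H] [Monoid S]

theorem isScalarTower_leftModuleOfRep {k : Type u} [Field k] {M : Type w} [AddCommGroup M]
    [Module k M] {H : Type v} [Monoid H] (ρ : H →* Module.End k M) :
    letI := leftModuleOfRep k ρ
    IsScalarTower k (MonoidAlgebra k H) M :=
  letI := leftModuleOfRep k ρ
  ⟨fun c a m => by
    change MonoidAlgebra.lift k _ _ ρ (c • a) m = c • MonoidAlgebra.lift k _ _ ρ a m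
    rw [map_smul, LinearMap.smul_apply]⟩

variable [CommSemiring k] [AddCommMonoid M] [Module k M] [Module (MonoidAlgebra k H) M]
  [IsScalarTower k (MonoidAlgebra k H) M]

theorem single_smul_eq_smul (h : H) (c : k) (m : M) :
    MonoidAlgebra.single h c • m = c • MonoidAlgebra.single h (1 : k) • m := by
  rw [← smul_assoc, MonoidAlgebra.smul_single, smul_eq_mul, mul_one]

theorem smulCommClass_of_single [Module (MonoidAlgebra k S)ᵐᵒᵖ M]
    [IsScalarTower k (MonoidAlgebra k S)ᵐᵒᵖ M]
    (hM : ∀ (h : H) (s : S) (m : M), MonoidAlgebra.single h (1 : k) • rightAct k s m =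
      rightAct k s (MonoidAlgebra.single h (1 : k) • m)) :
    SMulCommClass (MonoidAlgebra k H) (MonoidAlgebra k S)ᵐᵒᵖ M where
  smul_comm b a m := by
    induction b using MonoidAlgebra.induction_linear with
    | zero => simp only [zero_smul, smul_zero]
    | add b b' hb hb' => simp only [add_smul, smul_add, hb, hb']
    | single h c =>
      refine (linearMapOfRightAct (Algebra.lsmul k k M (MonoidAlgebra.single h c))
        fun s t => ?_).map_smul a m
      simp only [Algebra.lsmul_coe, single_smul_eq_smul h c, hM, map_smul]

theorem balanced_of_single {U W : Type*} [AddCommMonoid U] [Module k U]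
    [Module (MonoidAlgebra k H)ᵐᵒᵖ U] [IsScalarTower k (MonoidAlgebra k H)ᵐᵒᵖ U]
    [AddCommMonoid W] [Module k W] (f : M →ₗ[k] U →ₗ[k] W)
    (hf : ∀ m (h : H) u, f (MonoidAlgebra.single h (1 : k) • m) u = f m (rightAct k h u))
    (m : M) (b : MonoidAlgebra k H) (u : U) : f (b • m) u = f m (op b • u) := by
  induction b using MonoidAlgebra.induction_linear with
  | zero => simp only [op_zero, zero_smul, map_zero, LinearMap.zero_apply]
  | add a b ha hb => simp only [op_add, add_smul, map_add, LinearMap.add_apply, ha, hb]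
  | single h c =>
    rw [op_single_smul, single_smul_eq_smul, f.map_smul, (f m).map_smul, LinearMap.smul_apply, hf]

end Bimodule

namespace BalancedTensor

variable {k : Type u} [Field k] {B A U M W : Type*} [Ring B] [Ring A] [Algebra k A]
  [AddCommGroup U] [Module k U] [Module Bᵐᵒᵖ U]
  [AddCommGroup M] [Module k M] [Module B M] [Module Aᵐᵒᵖ M] [IsScalarTower k Aᵐᵒᵖ M]
  [AddCommGroup W] [Module k W]

variable (k B A U M) in
/-- The submodule of `M ⊗ U` by which `U ⊗_B M` is the quotient. -/
abbrev relations : Submodule Aᵐᵒᵖ (M ⊗[k] U) :=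
  Submodule.span Aᵐᵒᵖ
    {z | ∃ (u : U) (b : B) (m : M), z = m ⊗ₜ[k] (op b • u) - (b • m) ⊗ₜ[k] u}

/-- The canonical bilinear map `(m, u) ↦ u ⊗ m` into `U ⊗_B M`. -/
def mk : M →ₗ[k] U →ₗ[k] BalancedTensor k (B := B) A U M :=
  (TensorProduct.mk k M U).compr₂ ((relations k B A U M).mkQ.restrictScalars k)

theorem mk_smul_left (b : B) (m : M) (u : U) :
    (mk (b • m) u : BalancedTensor k (B := B) A U M) = mk m (op b • u) :=
  ((Submodule.Quotient.eq (relations k B A U M)).2 (Submodule.subset_span ⟨u, b, m, rfl⟩)).symm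

theorem smul_mk (a : Aᵐᵒᵖ) (m : M) (u : U) :
    a • (mk m u : BalancedTensor k (B := B) A U M) = mk (a • m) u :=
  congrArg (relations k B A U M).mkQ (TensorProduct.smul_tmul' a m u)

@[elab_as_elim]
theorem induction {p : BalancedTensor k (B := B) A U M → Prop}
    (t : BalancedTensor k (B := B) A U M) (zero : p 0) (add : ∀ s t, p s → p t → p (s + t))
    (mk : ∀ m u, p (mk m u)) : p t := by
  obtain ⟨z, rfl⟩ := Submodule.Quotient.mk_surjective _ t
  induction z using TensorProduct.induction_on with
  | zero => exact zero
  | tmul m u => exact mk m u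
  | add x y hx hy => exact add _ _ hx hy

variable [SMulCommClass B Aᵐᵒᵖ M]

theorem relations_le_ker_lift (f : M →ₗ[k] U →ₗ[k] W)
    (hf : ∀ (m : M) (b : B) (u : U), f (b • m) u = f m (op b • u)) :
    (relations k B A U M).restrictScalars k ≤ LinearMap.ker (TensorProduct.lift f) := by
  intro z hz
  suffices h : ∀ a : Aᵐᵒᵖ, TensorProduct.lift f (a • z) = 0 from one_smul Aᵐᵒᵖ z ▸ h 1
  rw [Submodule.restrictScalars_mem] at hz
  induction hz using Submodule.span_induction with
  | mem z hz =>
    obtain ⟨u, b, m, rfl⟩ := hz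
    intro a
    rw [smul_sub, TensorProduct.smul_tmul', TensorProduct.smul_tmul', map_sub,
      TensorProduct.lift.tmul, TensorProduct.lift.tmul, ← smul_comm b a m, hf, sub_self]
  | zero => intro a; rw [smul_zero, map_zero]
  | add x y _ _ hx hy => intro a; rw [smul_add, map_add, hx, hy, add_zero]
  | smul c x _ hx => intro a; rw [smul_smul, hx]

/-- The linear map out of `U ⊗_B M` given by a balanced bilinear map. -/
def lift (f : M →ₗ[k] U →ₗ[k] W)
    (hf : ∀ (m : M) (b : B) (u : U), f (b • m) u = f m (op b • u)) :
    BalancedTensor k (B := B) A U M →ₗ[k] W :=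
  Submodule.liftQ ((relations k B A U M).restrictScalars k) (TensorProduct.lift f)
      (relations_le_ker_lift f hf) ∘ₗ
    (Submodule.Quotient.restrictScalarsEquiv k (relations k B A U M)).symm.toLinearMap

theorem lift_mk (f : M →ₗ[k] U →ₗ[k] W)
    (hf : ∀ (m : M) (b : B) (u : U), f (b • m) u = f m (op b • u)) (m : M) (u : U) :
    lift f hf (mk m u : BalancedTensor k (B := B) A U M) = f m u :=
  TensorProduct.lift.tmul m u

end BalancedTensor

/-! ## The radical and the projectivity of induced modules -/

section RClass

variable {S : Type u} [Monoid S] {f : Idem S}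

theorem RClass.idem_mul (x : RClass f) : f.1 * x.val = x.val := by
  obtain ⟨a, ha⟩ := rightIdeal_subset_iff.1 x.mem.subset
  rw [ha, ← mul_assoc, f.2.eq]

variable (f) in
/-- The idempotent `f` as an element of its `R`-class. -/
def RClass.self : RClass f := ⟨f.1, rfl⟩

/-- The left action of `G_f` on the `R`-class of `f`. -/
def RClass.mulLeft (g : MaxSubgroup f) (x : RClass f) : RClass f :=
  ⟨g.toS * x.val, RClass.maxSubgroup_mul f g x⟩

theorem RClass.rightIdeal_mulLeft_mul_iff (g : MaxSubgroup f) (x : RClass f) (s : S) :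
    rightIdeal ((x.mulLeft g).val * s) = rightIdeal f.1 ↔
      rightIdeal (x.val * s) = rightIdeal f.1 := by
  constructor <;> intro h
  · have hx : g⁻¹.toS * (g.toS * x.val * s) = x.val * s := by
      rw [← mul_assoc, ← mul_assoc, g.inv_mul', x.idem_mul]
    exact hx ▸ RClass.maxSubgroup_mul f g⁻¹ ⟨_, h⟩
  · exact mul_assoc g.toS x.val s ▸ RClass.maxSubgroup_mul f g ⟨_, h⟩

variable [IsRRBG S]

/-- The element `xf` of `fSf`. -/
def RClass.toLocal (x : RClass f) : LocalMonoid f :=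
  ⟨x.val * f.1, x.val, by rw [x.idem_mul]⟩

theorem RClass.isUnit_toLocal (x : RClass f) : IsUnit x.toLocal := by
  obtain ⟨b, hb⟩ := rightIdeal_subset_iff.1 x.mem.symm.subset
  let y : LocalMonoid f := ⟨f.1 * b * f.1, b, rfl⟩
  have hxy : x.toLocal * y = 1 := LocalMonoid.ext <| by
    change x.val * f.1 * (f.1 * b * f.1) = f.1
    rw [mul_assoc f.1 b, IsRRBG.idem_mul, mul_assoc, IsRRBG.idem_mul, ← mul_assoc, ← hb, f.2.eq]
  -- Since `yS` is a two-sided ideal, the left inverse of `y` gives a right inverse.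
  obtain ⟨c, hc⟩ := IsRRBG.exists_mul x.toLocal.val y.val
  have hyc : y * ⟨f.1 * c * f.1, c, rfl⟩ = 1 := LocalMonoid.ext <| by
    change y.val * (f.1 * c * f.1) = f.1
    rw [← mul_assoc, ← mul_assoc, y.right, ← hc]
    exact (congrArg (·.val * f.1) hxy).trans f.2.eq
  exact ⟨⟨x.toLocal, y, hxy, left_inv_eq_right_inv hxy hyc ▸ hyc⟩, rfl⟩

/-- The retraction `x ↦ xf` of the `R`-class of `f` onto `G_f`. -/
def RClass.toGroup (x : RClass f) : MaxSubgroup f := x.isUnit_toLocal.unit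

theorem RClass.toGroup_mulLeft (g : MaxSubgroup f) (x : RClass f) :
    (x.mulLeft g).toGroup = g * x.toGroup :=
  MaxSubgroup.toS_injective (mul_assoc g.toS x.val f.1)

theorem RClass.toGroup_self : (RClass.self f).toGroup = 1 :=
  MaxSubgroup.toS_injective f.2

end RClass

section KR

variable (k : Type u) [Field k] {S : Type u} [Monoid S] {f : Idem S}

instance : IsScalarTower k (MonoidAlgebra k (MaxSubgroup f)) (KR k f) :=
  isScalarTower_leftModuleOfRep (KR.leftRep k f)

theorem KR.single_smul (g : MaxSubgroup f) (x : RClass f) :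
    MonoidAlgebra.single g (1 : k) • (Finsupp.single x 1 : KR k f) =
      Finsupp.single (x.mulLeft g) 1 := by
  change MonoidAlgebra.lift k _ _ (KR.leftRep k f) (MonoidAlgebra.single g 1) _ = _
  rw [MonoidAlgebra.lift_single, one_smul]
  exact Finsupp.mapDomain_single

theorem KR.rightAct_single (s : S) (x : RClass f) :
    rightAct k s (Finsupp.single x 1 : KR k f) = KR.act k f s x := by
  change (MonoidAlgebra.lift k _ _ (KR.rightRep k f) (MonoidAlgebra.single s 1)).unop _ = _
  rw [MonoidAlgebra.lift_single, one_smul]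
  change Finsupp.linearCombination k (KR.act k f s) (Finsupp.single x 1) = _
  rw [Finsupp.linearCombination_single, one_smul]

theorem KR.single_smul_act (g : MaxSubgroup f) (s : S) (x : RClass f) :
    MonoidAlgebra.single g (1 : k) • KR.act k f s x = KR.act k f s (x.mulLeft g) := by
  by_cases h : rightIdeal (x.val * s) = rightIdeal f.1
  · rw [KR.act, KR.act, dif_pos h, dif_pos ((RClass.rightIdeal_mulLeft_mul_iff g x s).2 h),
      KR.single_smul]
    exact congrArg (Finsupp.single · 1) (RClass.ext (mul_assoc _ _ _).symm)
  · rw [KR.act, KR.act, dif_neg h,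
      dif_neg (mt (RClass.rightIdeal_mulLeft_mul_iff g x s).1 h), smul_zero]

instance : SMulCommClass (MonoidAlgebra k (MaxSubgroup f)) (MonoidAlgebra k S)ᵐᵒᵖ (KR k f) :=
  smulCommClass_of_single (k := k) fun g s m => by
    have h : Algebra.lsmul k k (KR k f) (MonoidAlgebra.single g (1 : k)) ∘ₗ rightAct k s =
        rightAct k s ∘ₗ Algebra.lsmul k k (KR k f) (MonoidAlgebra.single g (1 : k)) :=
      Finsupp.lhom_ext' fun x => LinearMap.ext_ring <| by
        simp only [LinearMap.comp_apply, Finsupp.lsingle_apply, Algebra.lsmul_coe,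
          KR.single_smul, KR.rightAct_single, KR.single_smul_act]
    exact LinearMap.congr_fun h m

end KR

namespace Ind

variable (k : Type u) [Field k] {S : Type u} [Monoid S] {f : Idem S}
  {U : Type u} [AddCommGroup U] [Module k U] [Module (MonoidAlgebra k (MaxSubgroup f))ᵐᵒᵖ U]
  {W : Type*} [AddCommGroup W] [Module k W]

/-- The linear map `u ↦ u ⊗ x` into the induced module. -/
def tmul (x : RClass f) : U →ₗ[k] Ind k f U :=
  BalancedTensor.mk (Finsupp.single x 1)

variable {k}

theorem linearMap_ext {φ ψ : Ind k f U →ₗ[k] W}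
    (h : ∀ x u, φ (tmul k x u) = ψ (tmul k x u)) : φ = ψ := by
  refine LinearMap.ext fun t => ?_
  induction t using BalancedTensor.induction with
  | zero => rw [map_zero, map_zero]
  | add s t hs ht => rw [map_add, map_add, hs, ht]
  | mk m u =>
    have hm : φ ∘ₗ BalancedTensor.mk.flip u = ψ ∘ₗ BalancedTensor.mk.flip u :=
      Finsupp.lhom_ext' fun x => LinearMap.ext_ring (h x u)
    exact LinearMap.congr_fun hm m

theorem rightAct_tmul {x y : RClass f} {s : S} (h : x.val * s = y.val) (u : U) :
    rightAct k s (tmul k x u) = tmul k y u := by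
  have hxs : rightIdeal (x.val * s) = rightIdeal f.1 := h ▸ y.mem
  rw [rightAct_apply, tmul, BalancedTensor.smul_mk, ← rightAct_apply, KR.rightAct_single,
    KR.act, dif_pos hxs, show (⟨x.val * s, hxs⟩ : RClass f) = y from RClass.ext h, tmul]

theorem rightAct_tmul_eq_zero {x : RClass f} {s : S}
    (h : rightIdeal (x.val * s) ≠ rightIdeal f.1) (u : U) : rightAct k s (tmul k x u) = 0 := by
  rw [rightAct_apply, tmul, BalancedTensor.smul_mk, ← rightAct_apply, KR.rightAct_single,
    KR.act, dif_neg h, map_zero, LinearMap.zero_apply]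

theorem rightAct_tmul_self (x : RClass f) (u : U) :
    rightAct k x.val (tmul k (RClass.self f) u) = tmul k x u :=
  rightAct_tmul x.idem_mul u

theorem eq_top_of_tmul_self_mem {N : Submodule (MonoidAlgebra k S)ᵐᵒᵖ (Ind k f U)}
    (h : ∀ u, tmul k (RClass.self f) u ∈ N) : N = ⊤ := by
  have hN : (N.mkQ.restrictScalars k) = 0 := linearMap_ext fun x u => by
    rw [← rightAct_tmul_self]
    exact (Submodule.Quotient.mk_eq_zero N).2 (N.smul_mem _ (h u))
  exact eq_top_iff.2 fun t _ => (Submodule.Quotient.mk_eq_zero N).1 (LinearMap.congr_fun hN t)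

variable [IsScalarTower k (MonoidAlgebra k (MaxSubgroup f))ᵐᵒᵖ U]

theorem tmul_mulLeft (g : MaxSubgroup f) (x : RClass f) (u : U) :
    tmul k (x.mulLeft g) u = tmul k x (rightAct k g u) := by
  rw [tmul, ← KR.single_smul, BalancedTensor.mk_smul_left]
  rfl

theorem rightAct_toS_tmul_self (g : MaxSubgroup f) (u : U) :
    rightAct k g.toS (tmul k (RClass.self f) u) = tmul k (RClass.self f) (rightAct k g u) := by
  rw [← tmul_mulLeft]
  exact rightAct_tmul (g.left.trans g.right.symm) u

/-- The linear map `u ⊗ x ↦ φ x u` out of the induced module given by a balanced family `φ`. -/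
def lift (φ : RClass f → U →ₗ[k] W)
    (hφ : ∀ g x u, φ (x.mulLeft g) u = φ x (rightAct k g u)) : Ind k f U →ₗ[k] W :=
  BalancedTensor.lift (Finsupp.linearCombination k φ) <| balanced_of_single _ fun m g u => by
    have h : (Finsupp.linearCombination k φ).flip u ∘ₗ
          Algebra.lsmul k k (KR k f) (MonoidAlgebra.single g (1 : k)) =
        (Finsupp.linearCombination k φ).flip (rightAct k g u) :=
      Finsupp.lhom_ext' fun x => LinearMap.ext_ring <| by
        simp only [LinearMap.comp_apply, Finsupp.lsingle_apply, Algebra.lsmul_coe,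
          LinearMap.flip_apply, KR.single_smul, Finsupp.linearCombination_single, one_smul, hφ]
    exact LinearMap.congr_fun h m

theorem lift_tmul (φ : RClass f → U →ₗ[k] W)
    (hφ : ∀ g x u, φ (x.mulLeft g) u = φ x (rightAct k g u)) (x : RClass f) (u : U) :
    lift φ hφ (tmul k x u) = φ x u := by
  rw [lift, tmul, BalancedTensor.lift_mk, Finsupp.linearCombination_single, one_smul]

section Augmentation

variable [IsRRBG S]

variable (k f U) in
/-- The canonical map `Ind_f(U) → U`, `u ⊗ x ↦ u(xf)`. -/
def aug : Ind k f U →ₗ[k] U :=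
  lift (fun x => rightAct k x.toGroup) fun g x u => by rw [x.toGroup_mulLeft, rightAct_mul]

theorem aug_tmul_self (u : U) : aug k f U (tmul k (RClass.self f) u) = u := by
  rw [aug, lift_tmul, RClass.toGroup_self, rightAct_one]

theorem rightAct_idem (t : Ind k f U) :
    rightAct k f.1 t = tmul k (RClass.self f) (aug k f U t) := by
  have h : rightAct k f.1 = tmul k (RClass.self f) ∘ₗ aug k f U := linearMap_ext fun x u => by
    have hx : x.val * f.1 = ((RClass.self f).mulLeft x.toGroup).val := x.toGroup.right.symm
    rw [LinearMap.comp_apply, aug, lift_tmul, ← tmul_mulLeft, rightAct_tmul hx]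
  exact LinearMap.congr_fun h t

end Augmentation

end Ind

section Radical

variable (k : Type u) [Field k] {S : Type u} [Monoid S] [IsRRBG S] (f : Idem S)

/-- The submodule `{t | tf = 0}` of a right `kS`-module `T`.  For an induced module
`Ind_f(U)` with `U` simple it is the radical. -/
def idemKer (T : Type*) [AddCommGroup T] [Module k T] [Module (MonoidAlgebra k S)ᵐᵒᵖ T]
    [IsScalarTower k (MonoidAlgebra k S)ᵐᵒᵖ T] : Submodule (MonoidAlgebra k S)ᵐᵒᵖ T :=
  submoduleOfRightAct (LinearMap.ker (rightAct k f.1)) fun s t ht => by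
    rw [LinearMap.mem_ker] at ht ⊢
    rw [← rightAct_mul, ← IsRRBG.idem_mul, rightAct_mul, ht, map_zero]

section IdemKer

variable {k f} {T : Type*} [AddCommGroup T] [Module k T] [Module (MonoidAlgebra k S)ᵐᵒᵖ T]
  [IsScalarTower k (MonoidAlgebra k S)ᵐᵒᵖ T]

theorem mem_idemKer {t : T} : t ∈ idemKer k f T ↔ rightAct k f.1 t = 0 := Iff.rfl

theorem sub_rightAct_idem_mem_idemKer (t : T) : t - rightAct k f.1 t ∈ idemKer k f T := by
  rw [mem_idemKer, map_sub, ← rightAct_mul, f.2.eq, sub_self]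

theorem idemKer_one : idemKer k (oneIdem S) T = ⊥ := by
  ext t
  rw [mem_idemKer, Submodule.mem_bot]
  exact iff_of_eq (congrArg (· = 0) (rightAct_one k t))

end IdemKer

variable (U : Type u) [AddCommGroup U] [Module k U]
  [Module (MonoidAlgebra k (MaxSubgroup f))ᵐᵒᵖ U]
  [IsScalarTower k (MonoidAlgebra k (MaxSubgroup f))ᵐᵒᵖ U]
  [IsSimpleModule (MonoidAlgebra k (MaxSubgroup f))ᵐᵒᵖ U]

theorem isCoatom_idemKer_ind : IsCoatom (idemKer k f (Ind k f U)) := by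
  have : Nontrivial U := IsSimpleModule.nontrivial (MonoidAlgebra k (MaxSubgroup f))ᵐᵒᵖ U
  constructor
  · intro h
    obtain ⟨u, hu⟩ := exists_ne (0 : U)
    have hmem : Ind.tmul k (RClass.self f) u ∈ idemKer k f (Ind k f U) := h ▸ Submodule.mem_top
    rw [mem_idemKer, Ind.rightAct_idem, Ind.aug_tmul_self] at hmem
    exact hu (by rw [← Ind.aug_tmul_self (k := k) (f := f) u, hmem, map_zero])
  · intro N hN
    obtain ⟨t, htN, ht⟩ := SetLike.exists_of_lt hN
    let N' : Submodule (MonoidAlgebra k (MaxSubgroup f))ᵐᵒᵖ U :=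
      submoduleOfRightAct ((N.restrictScalars k).comap (Ind.tmul k (RClass.self f)))
        fun g u hu => by
          rw [Submodule.mem_comap, ← Ind.rightAct_toS_tmul_self]
          exact N.smul_mem _ hu
    have hN' : N' = ⊤ := (eq_bot_or_eq_top N').resolve_left fun h => ht <| by
      have hmem : Ind.aug k f U t ∈ N' := by
        change Ind.tmul k (RClass.self f) _ ∈ N
        rw [← Ind.rightAct_idem]
        exact N.smul_mem _ htN
      rw [h, Submodule.mem_bot] at hmem
      rw [mem_idemKer, Ind.rightAct_idem, hmem, map_zero]
    exact Ind.eq_top_of_tmul_self_mem fun u => show u ∈ N' from hN' ▸ Submodule.mem_top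

theorem jacobson_ind :
    Module.jacobson (MonoidAlgebra k S)ᵐᵒᵖ (Ind k f U) = idemKer k f (Ind k f U) := by
  refine le_antisymm (sInf_le (isCoatom_idemKer_ind k f U)) (le_sInf fun N hN => ?_)
  by_contra hle
  have htop : N ⊔ idemKer k f (Ind k f U) = ⊤ := hN.2 _ (left_lt_sup.2 hle)
  -- A supplement `N` of the kernel contains `Ind(U)f`, which generates `Ind(U)`.
  refine hN.1 (Ind.eq_top_of_tmul_self_mem fun u => ?_)
  obtain ⟨n, hn, t, ht, hnt⟩ := Submodule.mem_sup.1
    (htop ▸ Submodule.mem_top : Ind.tmul k (RClass.self f) u ∈ N ⊔ idemKer k f (Ind k f U))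
  rw [← Ind.rightAct_tmul_self, ← hnt, map_add]
  change rightAct k f.1 n + rightAct k f.1 t ∈ N
  rw [mem_idemKer.1 ht, add_zero]
  exact N.smul_mem _ hn

end Radical

section Inflation

variable {k : Type u} [Field k] {S : Type u} [Monoid S]

theorem MaxSubgroup.exists_toS_eq {s : S} (hs : IsUnit s) :
    ∃ g : MaxSubgroup (oneIdem S), g.toS = s := by
  obtain ⟨s, rfl⟩ := hs
  let toLocal (s : S) : LocalMonoid (oneIdem S) := ⟨s, s, by simp [oneIdem]⟩
  exact ⟨⟨toLocal s, toLocal ↑s⁻¹, LocalMonoid.ext s.mul_inv, LocalMonoid.ext s.inv_mul⟩, rfl⟩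

variable {V : Type*} [AddCommGroup V] [Module k V]
  [Module (MonoidAlgebra k (MaxSubgroup (oneIdem S)))ᵐᵒᵖ V]
  [IsScalarTower k (MonoidAlgebra k (MaxSubgroup (oneIdem S)))ᵐᵒᵖ V]
  {N : Type*} [AddCommGroup N] [Module k N] [Module (MonoidAlgebra k S)ᵐᵒᵖ N]
  [IsScalarTower k (MonoidAlgebra k S)ᵐᵒᵖ N]

/-- `j` identifies the `kS`-module `N` with the inflation of the `kG`-module `V`, where `G` is
the group of units of `S`: the units act on `N` as on `V`, and the non-units act by zero. -/
structure IsInflation (j : V ≃ₗ[k] N) : Prop where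
  map_rightAct : ∀ (g : MaxSubgroup (oneIdem S)) v, j (rightAct k g v) = rightAct k g.toS (j v)
  rightAct_eq_zero : ∀ s : S, ¬ IsUnit s → ∀ n : N, rightAct k s n = 0

theorem isUnit_of_rightIdeal_eq [Finite S] {s : S} (h : rightIdeal s = rightIdeal 1) :
    IsUnit s := by
  obtain ⟨a, ha⟩ := rightIdeal_subset_iff.1 h.symm.subset
  exact .of_mul_eq_one a ha.symm

theorem exists_isInflation_tilde_one [Finite S] [IsRRBG S] (V : Type u) [AddCommGroup V]
    [Module k V] [Module (MonoidAlgebra k (MaxSubgroup (oneIdem S)))ᵐᵒᵖ V]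
    [IsScalarTower k (MonoidAlgebra k (MaxSubgroup (oneIdem S)))ᵐᵒᵖ V]
    [IsSimpleModule (MonoidAlgebra k (MaxSubgroup (oneIdem S)))ᵐᵒᵖ V] :
    ∃ j : V ≃ₗ[k] Tilde k (oneIdem S) V, IsInflation (S := S) j := by
  let π : Ind k (oneIdem S) V →ₗ[(MonoidAlgebra k S)ᵐᵒᵖ] Tilde k (oneIdem S) V :=
    (Module.jacobson (MonoidAlgebra k S)ᵐᵒᵖ (Ind k (oneIdem S) V)).mkQ
  have hπ : Function.Injective π := by
    rw [← LinearMap.ker_eq_bot, Submodule.ker_mkQ, jacobson_ind, idemKer_one]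
  let ι : V →ₗ[k] Ind k (oneIdem S) V := Ind.tmul k (RClass.self (oneIdem S))
  have hι : Function.Injective ι := Function.LeftInverse.injective Ind.aug_tmul_self
  have hι' : Function.Surjective ι := fun t =>
    ⟨Ind.aug k _ V t, (Ind.rightAct_idem t).symm.trans (rightAct_one k t)⟩
  let j : V ≃ₗ[k] Tilde k (oneIdem S) V := LinearEquiv.ofBijective (π.restrictScalars k ∘ₗ ι)
    ⟨hπ.comp hι, (Submodule.mkQ_surjective _).comp hι'⟩
  refine ⟨j, fun g v => ?_, fun s hs n => ?_⟩
  · change π (ι _) = rightAct k g.toS (π (ι v))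
    rw [← map_rightAct, Ind.rightAct_toS_tmul_self]
  · obtain ⟨v, rfl⟩ := j.surjective n
    change rightAct k s (π (ι v)) = 0
    rw [← map_rightAct, Ind.rightAct_tmul_eq_zero, map_zero]
    exact fun h => hs (isUnit_of_rightIdeal_eq (one_mul s ▸ h))

end Inflation

section Average

instance {S : Type u} [Monoid S] [Finite S] (f : Idem S) : Finite (MaxSubgroup f) :=
  .of_injective _ MaxSubgroup.toS_injective

variable {k : Type u} [Field k] {S : Type u} [Monoid S] {f : Idem S} [Fintype (MaxSubgroup f)]
  {U : Type*} [AddCommGroup U] [Module k U] [Module (MonoidAlgebra k (MaxSubgroup f))ᵐᵒᵖ U]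
  [IsScalarTower k (MonoidAlgebra k (MaxSubgroup f))ᵐᵒᵖ U]
  {T : Type*} [AddCommGroup T] [Module k T] [Module (MonoidAlgebra k S)ᵐᵒᵖ T]
  [IsScalarTower k (MonoidAlgebra k S)ᵐᵒᵖ T]
  {T' : Type*} [AddCommGroup T'] [Module k T'] [Module (MonoidAlgebra k S)ᵐᵒᵖ T']
  [IsScalarTower k (MonoidAlgebra k S)ᵐᵒᵖ T']

variable (f) in
/-- The average over `G_f` of the conjugates of a linear map from a `kG_f`-module to a
`kS`-module. -/
def average (τ : U →ₗ[k] T) : U →ₗ[k] T :=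
  (Nat.card (MaxSubgroup f) : k)⁻¹ •
    ∑ h : MaxSubgroup f, rightAct k h.toS ∘ₗ τ ∘ₗ rightAct k h⁻¹

theorem average_apply (τ : U →ₗ[k] T) (u : U) :
    average f τ u = (Nat.card (MaxSubgroup f) : k)⁻¹ •
      ∑ h : MaxSubgroup f, rightAct k h.toS (τ (rightAct k h⁻¹ u)) := by
  simp only [average, LinearMap.smul_apply, LinearMap.sum_apply, LinearMap.comp_apply]

theorem average_rightAct (τ : U →ₗ[k] T) (g : MaxSubgroup f) (u : U) :
    average f τ (rightAct k g u) = rightAct k g.toS (average f τ u) := by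
  rw [average_apply, average_apply, map_smul, map_sum]
  congr 1
  refine Fintype.sum_equiv (Equiv.mulRight g⁻¹) _ _ fun h => ?_
  rw [Equiv.coe_mulRight, ← rightAct_mul, ← rightAct_mul, mul_inv_rev, inv_inv,
    ← MaxSubgroup.toS_mul, inv_mul_cancel_right]

theorem map_average [NeZero (Nat.card (MaxSubgroup f) : k)]
    (p : T →ₗ[(MonoidAlgebra k S)ᵐᵒᵖ] T') {τ : U →ₗ[k] T} {ι : U →ₗ[k] T'}
    (hτ : ∀ u, p (τ u) = ι u)
    (hι : ∀ (g : MaxSubgroup f) u, ι (rightAct k g u) = rightAct k g.toS (ι u)) (u : U) :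
    p (average f τ u) = ι u := by
  have hterm (h : MaxSubgroup f) : p (rightAct k h.toS (τ (rightAct k h⁻¹ u))) = ι u := by
    rw [map_rightAct, hτ, ← hι, ← rightAct_mul, inv_mul_cancel, rightAct_one]
  rw [average_apply, LinearMap.map_smul_of_tower, map_sum, Finset.sum_congr rfl fun h _ => hterm h,
    Finset.sum_const, Finset.card_univ, ← Nat.card_eq_fintype_card, ← Nat.cast_smul_eq_nsmul k,
    inv_smul_smul₀ (NeZero.ne _)]

end Average

section MinimalIdeal

variable {S : Type u} [Monoid S] [IsRRBG S] {e : MinIdem S}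

theorem rightIdeal_eq_iff_mem_minimalIdeal {x : S} :
    rightIdeal x = rightIdeal e.1.1 ↔ x ∈ minimalIdeal S := by
  constructor
  · intro h
    obtain ⟨a, rfl⟩ := rightIdeal_subset_iff.1 h.subset
    exact minimalIdeal_mul_right e.2 a
  · intro hx
    apply subset_antisymm
    · exact rightIdeal_subset_iff.2 ⟨x, (minIdem_mul e ⟨x, hx⟩).symm⟩
    · obtain ⟨a, b, hab⟩ := JLE_iff.1 (e.2 x)
      obtain ⟨c, hc⟩ := IsRRBG.exists_mul a x
      exact rightIdeal_subset_iff.2 ⟨c * b, by rw [hab, hc, mul_assoc]⟩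

/-- The right action of `S` on its minimal ideal, regarded as the `R`-class of `e`. -/
def RClass.mulRight (x : RClass e.1) (s : S) : RClass e.1 :=
  ⟨x.val * s, rightIdeal_eq_iff_mem_minimalIdeal.2 <|
    minimalIdeal_mul_right (rightIdeal_eq_iff_mem_minimalIdeal.1 x.mem) s⟩

variable {k : Type u} [Field k] {U : Type u} [AddCommGroup U] [Module k U]
  [Module (MonoidAlgebra k (MaxSubgroup e.1))ᵐᵒᵖ U]

theorem rightAct_tmul_eq_tmul_mulRight (s : S) (x : RClass e.1) (u : U) :
    rightAct k s (Ind.tmul k x u) = Ind.tmul k (x.mulRight s) u :=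
  Ind.rightAct_tmul rfl u

variable [IsScalarTower k (MonoidAlgebra k (MaxSubgroup e.1))ᵐᵒᵖ U]
  {T : Type*} [AddCommGroup T] [Module k T] [Module (MonoidAlgebra k S)ᵐᵒᵖ T]
  [IsScalarTower k (MonoidAlgebra k S)ᵐᵒᵖ T]

theorem exists_linearMap_tmul_eq (σ : U →ₗ[k] T)
    (hσ : ∀ (g : MaxSubgroup e.1) u, σ (rightAct k g u) = rightAct k g.toS (σ u)) :
    ∃ φ : Ind k e.1 U →ₗ[(MonoidAlgebra k S)ᵐᵒᵖ] T,
      ∀ x u, φ (Ind.tmul k x u) = rightAct k x.val (σ u) := by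
  let φ : Ind k e.1 U →ₗ[k] T := Ind.lift (fun x => rightAct k x.val ∘ₗ σ) fun g x u => by
    rw [LinearMap.comp_apply, LinearMap.comp_apply, hσ, ← rightAct_mul]
    rfl
  have hφ (x : RClass e.1) (u : U) : φ (Ind.tmul k x u) = rightAct k x.val (σ u) :=
    Ind.lift_tmul _ _ x u
  have hφ_act (s : S) : φ ∘ₗ rightAct k s = rightAct k s ∘ₗ φ := Ind.linearMap_ext fun x u => by
    rw [LinearMap.comp_apply, LinearMap.comp_apply, rightAct_tmul_eq_tmul_mulRight, hφ, hφ,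
      ← rightAct_mul]
    rfl
  exact ⟨linearMapOfRightAct φ fun s => LinearMap.congr_fun (hφ_act s), hφ⟩

variable [Finite S] [NeZero (Nat.card (MaxSubgroup e.1) : k)]

theorem exists_section_of_surjective_ind (p : T →ₗ[(MonoidAlgebra k S)ᵐᵒᵖ] Ind k e.1 U)
    (hp : Function.Surjective p) :
    ∃ q : Ind k e.1 U →ₗ[(MonoidAlgebra k S)ᵐᵒᵖ] T, p ∘ₗ q = LinearMap.id := by
  have := Fintype.ofFinite (MaxSubgroup e.1)
  obtain ⟨r, hr⟩ := (p.restrictScalars k).exists_rightInverse_of_surjective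
    (LinearMap.range_eq_top.2 hp)
  let ι : U →ₗ[k] Ind k e.1 U := Ind.tmul k (RClass.self e.1)
  have hσ (u : U) : p (average e.1 (r ∘ₗ ι) u) = ι u :=
    map_average p (fun u => LinearMap.congr_fun hr (ι u))
      (fun g u => (Ind.rightAct_toS_tmul_self g u).symm) u
  obtain ⟨q, hq⟩ := exists_linearMap_tmul_eq _ (average_rightAct (f := e.1) (r ∘ₗ ι))
  refine ⟨q, LinearMap.restrictScalars_injective k <| Ind.linearMap_ext fun x u => ?_⟩
  change p (q (Ind.tmul k x u)) = Ind.tmul k x u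
  rw [hq, map_rightAct, hσ, Ind.rightAct_tmul_self]

theorem projective_ind : Module.Projective (MonoidAlgebra k S)ᵐᵒᵖ (Ind k e.1 U) :=
  Module.Projective.of_lifting_property'' fun p hp => exists_section_of_surjective_ind p hp

end MinimalIdeal

/-! ## The projection of `kX` onto `M` -/

section ApproxClasses

variable {S : Type u} [Monoid S] [IsRRBG S] {e : MinIdem S}

/-- The class `[x]` in `X = J/≈`, for `x` in the minimal ideal `J` regarded as the `R`-class
of `e`. -/
def X.mk (x : RClass e.1) : X e := ⟦⟨x.val, rightIdeal_eq_iff_mem_minimalIdeal.1 x.mem⟩⟧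

theorem X.mk_surjective : Function.Surjective (X.mk : RClass e.1 → X e) := fun c => by
  obtain ⟨x, rfl⟩ := Quotient.exists_rep c
  exact ⟨⟨x.1, rightIdeal_eq_iff_mem_minimalIdeal.2 x.2⟩, rfl⟩

theorem X.toH_mk_eq_toGroup (x : RClass e.1) : X.toH e (X.mk x) = x.toGroup :=
  MaxSubgroup.toS_injective (X.toH_mk e _)

theorem X.mk_mulRight_eq_of_not_isUnit [Finite S] {w : S} (hw : ¬ IsUnit w) {x y : RClass e.1}
    (h : x.mulRight e.1.1 = y.mulRight e.1.1) : X.mk (x.mulRight w) = X.mk (y.mulRight w) := by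
  have hxy : x.val * e.1.1 = y.val * e.1.1 := congrArg RClass.val h
  by_cases hJ : w ∈ minimalIdeal S
  · have hew : e.1.1 * w = w := minIdem_mul e ⟨w, hJ⟩
    exact congrArg X.mk <| RClass.ext <| show x.val * w = y.val * w by
      rw [← hew, ← mul_assoc, ← mul_assoc, hxy]
  · -- The idempotent `tw` fixes both `xw` and `yw`.
    obtain ⟨t, ht⟩ := IsRRBG.regular w
    have hfix (z : S) : z * w * (t * w) = z * w := by rw [mul_assoc, ← mul_assoc w, ht]
    refine Quotient.sound (.rel _ _ ⟨?_, t * w, fun hu => hw ?_, fun hm => hJ ?_, hfix _, hfix _⟩)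
    · change x.val * w * e.1.1 = y.val * w * e.1.1
      rw [mul_assoc, mul_assoc, ← IsRRBG.idem_mul, ← mul_assoc, ← mul_assoc y.val, hxy]
    · exact isUnit_of_mul_isUnit_right hu
    · exact ht ▸ mul_assoc w t w ▸ minimalIdeal_mul_left hm w

theorem exists_lift_approx {α : Type*} (γ : RClass e.1 → α)
    (hγ : ∀ (x y : RClass e.1) (w : S), ¬ IsUnit w → x.mulRight e.1.1 = y.mulRight e.1.1 →
      x.mulRight w = x → y.mulRight w = y → γ x = γ y) :
    ∃ φ : X e → α, ∀ x, φ (X.mk x) = γ x := by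
  let γ' (x : minimalIdeal S) : α := γ ⟨x.1, rightIdeal_eq_iff_mem_minimalIdeal.2 x.2⟩
  have happrox (x y : minimalIdeal S) (h : Relation.EqvGen (Smile e) x y) : γ' x = γ' y := by
    induction h with
    | rel x y h =>
      obtain ⟨hxy, w, hw, -, hx, hy⟩ := h
      exact hγ _ _ w hw (RClass.ext hxy) (RClass.ext hx) (RClass.ext hy)
    | refl x => rfl
    | symm x y _ ih => exact ih.symm
    | trans x y z _ _ hxy hyz => exact hxy.trans hyz
  exact ⟨Quotient.lift γ' happrox, fun _ => rfl⟩

end ApproxClasses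

section Bimodule

variable (k : Type u) [Field k] {S : Type u} [Monoid S] [IsRRBG S] (e : MinIdem S)

instance : IsScalarTower k (MonoidAlgebra k (MaxSubgroup e.1)) (KX k e) :=
  isScalarTower_leftModuleOfRep (KX.leftRep k e)

instance : IsScalarTower k (MonoidAlgebra k (MaxSubgroup (oneIdem S)))ᵐᵒᵖ (KX k e) where
  smul_assoc c a x := by
    change AlgHom.opComm (MonoidAlgebra.lift k _ _ (KX.rightRep k e)) (c • a) x =
      c • AlgHom.opComm (MonoidAlgebra.lift k _ _ (KX.rightRep k e)) a x
    rw [map_smul, LinearMap.smul_apply]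

variable {e}

/-- The basis vector `[x]` of `kX`. -/
def KX.of (x : RClass e.1) : KX k e := Finsupp.single (X.mk x) 1

variable {k}

theorem KX.linearMap_ext {W : Type*} [AddCommGroup W] [Module k W] {φ ψ : KX k e →ₗ[k] W}
    (h : ∀ x : RClass e.1, φ (KX.of k x) = ψ (KX.of k x)) : φ = ψ :=
  Finsupp.lhom_ext' <| X.mk_surjective.forall.2 fun x => LinearMap.ext_ring (h x)

theorem KX.rightAct_of (g : MaxSubgroup (oneIdem S)) (x : RClass e.1) :
    rightAct k g (KX.of k x) = KX.of k (x.mulRight g.toS) := by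
  rw [rightAct_apply, KX.of, KX.op_single_smul, one_mul]
  rfl

theorem KX.single_smul_of (h : MaxSubgroup e.1) (x : RClass e.1) :
    MonoidAlgebra.single h (1 : k) • KX.of k x = KX.of k (x.mulLeft h) := by
  rw [KX.of, KX.single_smul, one_mul]
  rfl

theorem eps_of (x : RClass e.1) :
    eps k e (KX.of k x) = MonoidAlgebra.single x.toGroup 1 := by
  rw [KX.of, eps_single, X.toH_mk_eq_toGroup]

variable (k e)

instance : SMulCommClass (MonoidAlgebra k (MaxSubgroup e.1))
    (MonoidAlgebra k (MaxSubgroup (oneIdem S)))ᵐᵒᵖ (KX k e) :=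
  smulCommClass_of_single (k := k) fun h g m => by
    have hcomm : Algebra.lsmul k k (KX k e) (MonoidAlgebra.single h (1 : k)) ∘ₗ rightAct k g =
        rightAct k g ∘ₗ Algebra.lsmul k k (KX k e) (MonoidAlgebra.single h (1 : k)) :=
      KX.linearMap_ext fun x => by
        simp only [LinearMap.comp_apply, Algebra.lsmul_coe, KX.rightAct_of, KX.single_smul_of]
        exact congrArg (KX.of k) (RClass.ext (mul_assoc _ _ _).symm)
    exact LinearMap.congr_fun hcomm m

instance : IsScalarTower k (MonoidAlgebra k (MaxSubgroup e.1)) (BimodM k e) where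
  smul_assoc c a m := Subtype.ext (smul_assoc c a m.1)

instance : SMulCommClass (MonoidAlgebra k (MaxSubgroup e.1))
    (MonoidAlgebra k (MaxSubgroup (oneIdem S)))ᵐᵒᵖ (BimodM k e) where
  smul_comm a b m := Subtype.ext (smul_comm a b m.1)

/-- The projection `kX → M` along the left `kH`-submodule generated by `[e]`. -/
def projM : KX k e →ₗ[k] BimodM k e :=
  LinearMap.codRestrict _ (LinearMap.id -
      (LinearMap.toSpanSingleton (MonoidAlgebra k (MaxSubgroup e.1)) (KX k e)
        (KX.of k (RClass.self e.1))).restrictScalars k ∘ₗ eps k e) fun y => by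
    change eps k e (y - eps k e y • KX.of k (RClass.self e.1)) = 0
    rw [map_sub, eps_left, eps_of, RClass.toGroup_self, ← MonoidAlgebra.one_def, mul_one, sub_self]

variable {k e}

theorem coe_projM (y : KX k e) :
    (projM k e y : KX k e) = y - eps k e y • KX.of k (RClass.self e.1) := rfl

theorem projM_coe (m : BimodM k e) : projM k e m = m := Subtype.ext <| by
  rw [coe_projM, LinearMap.mem_ker.1 m.2, zero_smul, sub_zero]

theorem projM_smul (a : MonoidAlgebra k (MaxSubgroup e.1)) (y : KX k e) :
    projM k e (a • y) = a • projM k e y := Subtype.ext <| by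
  change (projM k e (a • y) : KX k e) = a • (projM k e y : KX k e)
  rw [coe_projM, coe_projM, eps_left, smul_sub, mul_smul]

theorem RClass.mulRight_idem (x : RClass e.1) :
    x.mulRight e.1.1 = (RClass.self e.1).mulLeft x.toGroup :=
  RClass.ext x.toGroup.right.symm

theorem RClass.mulRight_idem_mulRight_idem (x : RClass e.1) (s : S) :
    ((x.mulRight e.1.1).mulRight s).mulRight e.1.1 = (x.mulRight s).mulRight e.1.1 :=
  RClass.ext <| show x.val * e.1.1 * s * e.1.1 = x.val * s * e.1.1 by
    rw [mul_assoc, mul_assoc, IsRRBG.idem_mul, mul_assoc]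

theorem coe_projM_of (x : RClass e.1) :
    (projM k e (KX.of k x) : KX k e) = KX.of k x - KX.of k (x.mulRight e.1.1) := by
  rw [coe_projM, eps_of, KX.single_smul_of, x.mulRight_idem]

theorem projM_of_mulRight_idem (x : RClass e.1) :
    projM k e (KX.of k (x.mulRight e.1.1)) = 0 := Subtype.ext <| by
  have hx : (x.mulRight e.1.1).mulRight e.1.1 = x.mulRight e.1.1 :=
    RClass.ext ((mul_assoc _ _ _).trans (congrArg (x.val * ·) e.1.2))
  rw [coe_projM_of, hx, sub_self, ZeroMemClass.coe_zero]

theorem rightAct_projM_of (g : MaxSubgroup (oneIdem S)) (x : RClass e.1) :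
    rightAct k g (projM k e (KX.of k x)) = projM k e (KX.of k (x.mulRight g.toS)) -
      projM k e (KX.of k ((x.mulRight e.1.1).mulRight g.toS)) := Subtype.ext <| by
  change rightAct k g (projM k e (KX.of k x) : KX k e) = (projM k e _ : KX k e) - projM k e _
  rw [coe_projM_of, coe_projM_of, coe_projM_of, map_sub, KX.rightAct_of,
    KX.rightAct_of, RClass.mulRight_idem_mulRight_idem, sub_sub_sub_cancel_right]

end Bimodule

/-! ## Homomorphisms from the radical of an induced module -/

section IdemKerProjection

variable (k : Type u) [Field k] {S : Type u} [Monoid S] [IsRRBG S] (f : Idem S)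
  (T : Type*) [AddCommGroup T] [Module k T] [Module (MonoidAlgebra k S)ᵐᵒᵖ T]
  [IsScalarTower k (MonoidAlgebra k S)ᵐᵒᵖ T]

/-- The projection `t ↦ t - tf` of a right `kS`-module `T` onto `{t | tf = 0}`. -/
def toIdemKer : T →ₗ[k] idemKer k f T :=
  LinearMap.codRestrict ((idemKer k f T).restrictScalars k) (LinearMap.id - rightAct k f.1)
    sub_rightAct_idem_mem_idemKer

variable {k f T}

theorem toIdemKer_coe (t : idemKer k f T) : toIdemKer k f T t = t :=
  Subtype.ext <| show (t : T) - rightAct k f.1 (t : T) = t by rw [mem_idemKer.1 t.2, sub_zero]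

theorem toIdemKer_rightAct_idem (t : T) : toIdemKer k f T (rightAct k f.1 t) = 0 :=
  Subtype.ext <| show rightAct k f.1 t - rightAct k f.1 (rightAct k f.1 t) = 0 by
    rw [← rightAct_mul, f.2.eq, sub_self]

end IdemKerProjection

section HomIntoInflation

variable {k : Type u} [Field k] {S : Type u} [Monoid S] [IsRRBG S] {f : Idem S}
  {U : Type u} [AddCommGroup U] [Module k U] [Module (MonoidAlgebra k (MaxSubgroup f))ᵐᵒᵖ U]
  {N : Type*} [AddCommGroup N] [Module k N] [Module (MonoidAlgebra k S)ᵐᵒᵖ N]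
  [IsScalarTower k (MonoidAlgebra k S)ᵐᵒᵖ N]

theorem idemKer_ind_le_ker (hN : ∀ s : S, ¬ IsUnit s → ∀ n : N, rightAct k s n = 0)
    (φ : Ind k f U →ₗ[(MonoidAlgebra k S)ᵐᵒᵖ] N) :
    idemKer k f (Ind k f U) ≤ LinearMap.ker φ := by
  intro t ht
  rw [LinearMap.mem_ker]
  by_cases hf : IsUnit f.1
  · have hf1 : f.1 = 1 := hf.mul_left_cancel (f.2.eq.trans (mul_one _).symm)
    rw [← rightAct_one k (S := S) t, ← hf1, mem_idemKer.1 ht, map_zero]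
  · have hφ : φ.restrictScalars k = 0 := Ind.linearMap_ext fun x u => by
      have hu : rightAct k f.1 (Ind.tmul k (RClass.self f) u) = Ind.tmul k _ u :=
        Ind.rightAct_tmul_self (RClass.self f) u
      change φ (Ind.tmul k x u) = 0
      rw [← Ind.rightAct_tmul_self, ← hu, map_rightAct, map_rightAct, hN _ hf, map_zero]
    exact LinearMap.congr_fun hφ t

end HomIntoInflation

section Comparison

variable {k : Type u} [Field k] {S : Type u} [Monoid S] [IsRRBG S] {e : MinIdem S}
  {U : Type u} [AddCommGroup U] [Module k U] [Module (MonoidAlgebra k (MaxSubgroup e.1))ᵐᵒᵖ U]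

variable (k e U) in
/-- The right `kG`-module `U ⊗_{kH} M`. -/
abbrev TensorM : Type u :=
  BalancedTensor k (B := MonoidAlgebra k (MaxSubgroup e.1))
    (MonoidAlgebra k (MaxSubgroup (oneIdem S))) U (BimodM k e)

variable [IsScalarTower k (MonoidAlgebra k (MaxSubgroup e.1))ᵐᵒᵖ U]

variable (k e U) in
/-- The linear map `u ⊗ x ↦ u ⊗ ([x] - [xe])` from `Ind_e(U)` to `U ⊗_{kH} M`. -/
def indToTensor : Ind k e.1 U →ₗ[k] TensorM k e U :=
  Ind.lift (fun x => BalancedTensor.mk (projM k e (KX.of k x))) fun h x u => by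
    rw [← KX.single_smul_of, projM_smul, BalancedTensor.mk_smul_left, rightAct_apply]

theorem indToTensor_tmul (x : RClass e.1) (u : U) :
    indToTensor k e U (Ind.tmul k x u) = BalancedTensor.mk (projM k e (KX.of k x)) u :=
  Ind.lift_tmul _ _ x u

theorem indToTensor_rightAct_idem (t : Ind k e.1 U) :
    indToTensor k e U (rightAct k e.1.1 t) = 0 := by
  have h : indToTensor k e U ∘ₗ rightAct k e.1.1 = 0 := Ind.linearMap_ext fun x u => by
    rw [LinearMap.comp_apply, rightAct_tmul_eq_tmul_mulRight, indToTensor_tmul,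
      projM_of_mulRight_idem, map_zero, LinearMap.zero_apply, LinearMap.zero_apply]
  exact LinearMap.congr_fun h t

theorem indToTensor_rightAct {t : Ind k e.1 U} (ht : t ∈ idemKer k e.1 (Ind k e.1 U))
    (g : MaxSubgroup (oneIdem S)) :
    indToTensor k e U (rightAct k g.toS t) = rightAct k g (indToTensor k e U t) := by
  have h : indToTensor k e U ∘ₗ rightAct k g.toS ∘ₗ (LinearMap.id - rightAct k e.1.1) =
      rightAct k g ∘ₗ indToTensor k e U := Ind.linearMap_ext fun x u => by
    simp only [LinearMap.comp_apply, LinearMap.sub_apply, LinearMap.id_apply, map_sub,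
      rightAct_tmul_eq_tmul_mulRight, indToTensor_tmul]
    rw [rightAct_apply, BalancedTensor.smul_mk, ← rightAct_apply, rightAct_projM_of]
    exact (LinearMap.map_sub₂ BalancedTensor.mk _ _ u).symm
  calc indToTensor k e U (rightAct k g.toS t)
      = indToTensor k e U (rightAct k g.toS (t - rightAct k e.1.1 t)) := by
        rw [mem_idemKer.1 ht, sub_zero]
    _ = rightAct k g (indToTensor k e U t) := LinearMap.congr_fun h t

theorem indToTensor_rightAct_of_not_isUnit [Finite S] {t : Ind k e.1 U}
    (ht : t ∈ idemKer k e.1 (Ind k e.1 U)) {w : S} (hw : ¬ IsUnit w) :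
    indToTensor k e U (rightAct k w t) = 0 := by
  have h : indToTensor k e U ∘ₗ rightAct k w =
      indToTensor k e U ∘ₗ rightAct k w ∘ₗ rightAct k e.1.1 := Ind.linearMap_ext fun x u => by
    have hx : x.mulRight e.1.1 = (x.mulRight e.1.1).mulRight e.1.1 :=
      RClass.ext <| show x.val * e.1.1 = x.val * e.1.1 * e.1.1 by rw [mul_assoc, e.1.2.eq]
    simp only [LinearMap.comp_apply, rightAct_tmul_eq_tmul_mulRight, indToTensor_tmul]
    rw [KX.of, KX.of, X.mk_mulRight_eq_of_not_isUnit hw hx]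
  calc indToTensor k e U (rightAct k w t)
      = indToTensor k e U (rightAct k w (rightAct k e.1.1 t)) := LinearMap.congr_fun h t
    _ = 0 := by rw [mem_idemKer.1 ht, map_zero, map_zero]

theorem exists_mem_idemKer_indToTensor_eq (q : TensorM k e U) :
    ∃ t ∈ idemKer k e.1 (Ind k e.1 U), indToTensor k e U t = q := by
  suffices h : q ∈ LinearMap.range (indToTensor k e U) by
    obtain ⟨t, rfl⟩ := h
    exact ⟨_, sub_rightAct_idem_mem_idemKer t, by
      rw [map_sub, indToTensor_rightAct_idem, sub_zero]⟩
  induction q using BalancedTensor.induction with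
  | zero => exact Submodule.zero_mem _
  | add x y hx hy => exact Submodule.add_mem _ hx hy
  | mk m u =>
    have h : (LinearMap.range (indToTensor k e U)).mkQ ∘ₗ
        BalancedTensor.mk.flip u ∘ₗ projM k e = 0 := KX.linearMap_ext fun x =>
      (Submodule.Quotient.mk_eq_zero _).2 ⟨Ind.tmul k x u, indToTensor_tmul x u⟩
    rw [← projM_coe m]
    exact (Submodule.Quotient.mk_eq_zero _).1 (LinearMap.congr_fun h m.1)

theorem exists_comp_indToTensor_eq {V : Type*} [AddCommGroup V] [Module k V]
    (γ : Ind k e.1 U →ₗ[k] V) (hγ_idem : ∀ t, γ (rightAct k e.1.1 t) = 0)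
    (hγ : ∀ w : S, ¬ IsUnit w → ∀ t ∈ idemKer k e.1 (Ind k e.1 U), γ (rightAct k w t) = 0) :
    ∃ F : TensorM k e U →ₗ[k] V, F ∘ₗ indToTensor k e U = γ := by
  obtain ⟨φ', hφ'⟩ := exists_lift_approx (fun x => γ ∘ₗ Ind.tmul k x) fun x y w hw hxy hx hy =>
    LinearMap.ext fun u => by
      rw [← sub_eq_zero, LinearMap.comp_apply, LinearMap.comp_apply, ← map_sub]
      nth_rw 1 [← hx, ← hy]
      rw [← rightAct_tmul_eq_tmul_mulRight, ← rightAct_tmul_eq_tmul_mulRight, ← map_sub]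
      refine hγ w hw _ ?_
      rw [mem_idemKer, map_sub, rightAct_tmul_eq_tmul_mulRight, rightAct_tmul_eq_tmul_mulRight,
        hxy, sub_self]
  let φ : KX k e →ₗ[k] U →ₗ[k] V := Finsupp.linearCombination k φ'
  have hφ (x : RClass e.1) (u : U) : φ (KX.of k x) u = γ (Ind.tmul k x u) := by
    rw [KX.of, Finsupp.linearCombination_single, one_smul, hφ', LinearMap.comp_apply]
  have hφ_bal (y : KX k e) (h : MaxSubgroup e.1) (u : U) :
      φ (MonoidAlgebra.single h (1 : k) • y) u = φ y (rightAct k h u) := by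
    have heq : φ.flip u ∘ₗ Algebra.lsmul k k (KX k e) (MonoidAlgebra.single h (1 : k)) =
        φ.flip (rightAct k h u) := KX.linearMap_ext fun x => by
      simp only [LinearMap.comp_apply, Algebra.lsmul_coe, LinearMap.flip_apply,
        KX.single_smul_of, hφ, Ind.tmul_mulLeft]
    exact LinearMap.congr_fun heq y
  let ψ : BimodM k e →ₗ[k] U →ₗ[k] V := φ ∘ₗ (LinearMap.ker (eps k e)).subtype
  refine ⟨BalancedTensor.lift ψ (balanced_of_single ψ fun m => hφ_bal m),
    Ind.linearMap_ext fun x u => ?_⟩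
  rw [LinearMap.comp_apply, indToTensor_tmul, BalancedTensor.lift_mk]
  change φ (projM k e _ : KX k e) u = _
  rw [coe_projM_of, map_sub, LinearMap.sub_apply, hφ, hφ, ← rightAct_tmul_eq_tmul_mulRight,
    hγ_idem, sub_zero]

variable {V : Type*} [AddCommGroup V] [Module k V]
  [Module (MonoidAlgebra k (MaxSubgroup (oneIdem S)))ᵐᵒᵖ V]
  [IsScalarTower k (MonoidAlgebra k (MaxSubgroup (oneIdem S)))ᵐᵒᵖ V]
  {N : Type*} [AddCommGroup N] [Module k N] [Module (MonoidAlgebra k S)ᵐᵒᵖ N]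
  [IsScalarTower k (MonoidAlgebra k S)ᵐᵒᵖ N] {j : V ≃ₗ[k] N}

theorem exists_linearMap_indToTensor_eq (hj : IsInflation (S := S) j)
    (f : idemKer k e.1 (Ind k e.1 U) →ₗ[(MonoidAlgebra k S)ᵐᵒᵖ] N) :
    ∃ F : TensorM k e U →ₗ[(MonoidAlgebra k (MaxSubgroup (oneIdem S)))ᵐᵒᵖ] V,
      ∀ t : idemKer k e.1 (Ind k e.1 U), j (F (indToTensor k e U t)) = f t := by
  let γ : Ind k e.1 U →ₗ[k] V :=
    j.symm.toLinearMap ∘ₗ f.restrictScalars k ∘ₗ toIdemKer k e.1 (Ind k e.1 U)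
  have hγ (t : idemKer k e.1 (Ind k e.1 U)) : j (γ t) = f t :=
    (j.apply_symm_apply _).trans (congrArg f (toIdemKer_coe t))
  have hγ_act (s : S) (t : idemKer k e.1 (Ind k e.1 U)) :
      j (γ (rightAct k s t)) = rightAct k s (f t) := by
    rw [← map_rightAct, ← hγ, coe_rightAct]
  obtain ⟨F, hF⟩ := exists_comp_indToTensor_eq γ
    (fun t => show j.symm (f (toIdemKer k e.1 _ _)) = 0 by
      rw [toIdemKer_rightAct_idem, map_zero, map_zero])
    (fun w hw t ht => j.map_eq_zero_iff.1 <|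
      (hγ_act w ⟨t, ht⟩).trans (hj.rightAct_eq_zero w hw _))
  have hF_coe (t : Ind k e.1 U) : F (indToTensor k e U t) = γ t := LinearMap.congr_fun hF t
  refine ⟨linearMapOfRightAct F fun g q => ?_, fun t => ?_⟩
  · obtain ⟨t, ht, rfl⟩ := exists_mem_idemKer_indToTensor_eq q
    apply j.injective
    rw [← indToTensor_rightAct ht, hF_coe, hF_coe, hj.map_rightAct, hγ_act g.toS ⟨t, ht⟩,
      ← hγ ⟨t, ht⟩]
  · exact (congrArg j (hF_coe t)).trans (hγ t)

/-- The map `Hom_{kG}(U ⊗_{kH} M, V) → Hom_{kS}(Ind_e(U)(1 - e), N)` induced by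
`u ⊗ x ↦ u ⊗ ([x] - [xe])`, for `N` the inflation of `V`. -/
def homIdemKerOfHomTensor [Finite S] (hj : IsInflation (S := S) j) :
    (TensorM k e U →ₗ[(MonoidAlgebra k (MaxSubgroup (oneIdem S)))ᵐᵒᵖ] V) →ₗ[k]
      (idemKer k e.1 (Ind k e.1 U) →ₗ[(MonoidAlgebra k S)ᵐᵒᵖ] N) where
  toFun F := linearMapOfRightAct (j.toLinearMap ∘ₗ F.restrictScalars k ∘ₗ indToTensor k e U ∘ₗ
      (idemKer k e.1 (Ind k e.1 U)).subtype.restrictScalars k) fun s t => by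
    change j (F (indToTensor k e U (rightAct k s t.1))) =
      rightAct k s (j (F (indToTensor k e U t.1)))
    by_cases hs : IsUnit s
    · obtain ⟨g, rfl⟩ := MaxSubgroup.exists_toS_eq hs
      rw [indToTensor_rightAct t.2, map_rightAct, hj.map_rightAct]
    · rw [indToTensor_rightAct_of_not_isUnit t.2 hs, map_zero, map_zero,
        hj.rightAct_eq_zero s hs]
  map_add' F F' := LinearMap.ext fun t => j.map_add _ _
  map_smul' c F := LinearMap.ext fun t => j.map_smul _ _

theorem bijective_homIdemKerOfHomTensor [Finite S] (hj : IsInflation (S := S) j) :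
    Function.Bijective (homIdemKerOfHomTensor (e := e) (U := U) hj) := by
  refine ⟨fun F F' h => LinearMap.ext fun q => ?_, fun f => ?_⟩
  · obtain ⟨t, ht, rfl⟩ := exists_mem_idemKer_indToTensor_eq q
    exact j.injective (LinearMap.congr_fun h ⟨t, ht⟩)
  · obtain ⟨F, hF⟩ := exists_linearMap_indToTensor_eq hj f
    exact ⟨F, LinearMap.ext hF⟩

end Comparison

theorem rank_ext_one_tilde {k S : Type u} [Field k] [Monoid S] [Finite S] [IsRRBG S]
    {e : MinIdem S} [NeZero (Nat.card (MaxSubgroup e.1) : k)]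
    {U : Type u} [AddCommGroup U] [Module k U] [Module (MonoidAlgebra k (MaxSubgroup e.1))ᵐᵒᵖ U]
    [IsScalarTower k (MonoidAlgebra k (MaxSubgroup e.1))ᵐᵒᵖ U]
    [IsSimpleModule (MonoidAlgebra k (MaxSubgroup e.1))ᵐᵒᵖ U]
    {V : Type u} [AddCommGroup V] [Module k V]
    [Module (MonoidAlgebra k (MaxSubgroup (oneIdem S)))ᵐᵒᵖ V]
    [IsScalarTower k (MonoidAlgebra k (MaxSubgroup (oneIdem S)))ᵐᵒᵖ V]
    {N : Type u} [AddCommGroup N] [Module k N] [Module (MonoidAlgebra k S)ᵐᵒᵖ N]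
    [IsScalarTower k (MonoidAlgebra k S)ᵐᵒᵖ N] {j : V ≃ₗ[k] N} (hj : IsInflation (S := S) j) :
    Module.rank k (CategoryTheory.Abelian.Ext (ModuleCat.of (MonoidAlgebra k S)ᵐᵒᵖ (Tilde k e.1 U))
        (ModuleCat.of (MonoidAlgebra k S)ᵐᵒᵖ N) 1) =
      Module.rank k (TensorM k e U →ₗ[(MonoidAlgebra k (MaxSubgroup (oneIdem S)))ᵐᵒᵖ] V) := by
  have := projective_ind (k := k) (e := e) (U := U)
  have hker (f : Ind k e.1 U →ₗ[(MonoidAlgebra k S)ᵐᵒᵖ] N) :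
      Module.jacobson (MonoidAlgebra k S)ᵐᵒᵖ (Ind k e.1 U) ≤ LinearMap.ker f :=
    (jacobson_ind k e.1 U).trans_le (idemKer_ind_le_ker hj.rightAct_eq_zero f)
  rw [rank_ext_one_quotient k _ hker, jacobson_ind]
  exact (LinearEquiv.ofBijective _ (bijective_homIdemKerOfHomTensor hj)).rank_eq.symm

theorem finiteDimensional_of_isSimpleModule (k : Type*) [Field k] {S : Type*} [Monoid S]
    [Finite S] (f : Idem S) (W : Type*) [AddCommGroup W] [Module k W]
    [Module (MonoidAlgebra k (MaxSubgroup f))ᵐᵒᵖ W]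
    [IsScalarTower k (MonoidAlgebra k (MaxSubgroup f))ᵐᵒᵖ W]
    [IsSimpleModule (MonoidAlgebra k (MaxSubgroup f))ᵐᵒᵖ W] : FiniteDimensional k W :=
  have : Module.Finite k (MonoidAlgebra k (MaxSubgroup f))ᵐᵒᵖ :=
    .equiv (MulOpposite.opLinearEquiv k)
  Module.Finite.trans (MonoidAlgebra k (MaxSubgroup f))ᵐᵒᵖ W

end RRBG

end

theorem theorem5p14_general {k S : Type u} [Field k] [IsAlgClosed k]
    [Monoid S] [Finite S] [RRBG.IsRRBG S] (e : RRBG.MinIdem S)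
    (hH : ¬ ringChar k ∣ Nat.card (RRBG.MaxSubgroup e.1))
    (hG : ¬ ringChar k ∣ Nat.card (RRBG.MaxSubgroup (RRBG.oneIdem S)))
    (U : Type u) [AddCommGroup U] [Module k U]
    [Module (MonoidAlgebra k (RRBG.MaxSubgroup e.1))ᵐᵒᵖ U]
    [IsScalarTower k (MonoidAlgebra k (RRBG.MaxSubgroup e.1))ᵐᵒᵖ U]
    [IsSimpleModule (MonoidAlgebra k (RRBG.MaxSubgroup e.1))ᵐᵒᵖ U]
    (V : Type u) [AddCommGroup V] [Module k V]
    [Module (MonoidAlgebra k (RRBG.MaxSubgroup (RRBG.oneIdem S)))ᵐᵒᵖ V]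
    [IsScalarTower k (MonoidAlgebra k (RRBG.MaxSubgroup (RRBG.oneIdem S)))ᵐᵒᵖ V]
    [IsSimpleModule (MonoidAlgebra k (RRBG.MaxSubgroup (RRBG.oneIdem S)))ᵐᵒᵖ V] :
    ∃ m : ℕ,
      RRBG.IsCompositionMultiplicity
        (MonoidAlgebra k (RRBG.MaxSubgroup (RRBG.oneIdem S)))ᵐᵒᵖ V
        (RRBG.BalancedTensor k (B := MonoidAlgebra k (RRBG.MaxSubgroup e.1))
          (MonoidAlgebra k (RRBG.MaxSubgroup (RRBG.oneIdem S))) U (RRBG.BimodM k e)) m ∧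
      Module.rank k
        (CategoryTheory.Abelian.Ext
          (ModuleCat.of (MonoidAlgebra k S)ᵐᵒᵖ (RRBG.Tilde k e.1 U))
          (ModuleCat.of (MonoidAlgebra k S)ᵐᵒᵖ (RRBG.Tilde k (RRBG.oneIdem S) V)) 1) = m := by
  have : NeZero (Nat.card (RRBG.MaxSubgroup e.1) : k) := ⟨mt (ringChar.spec k _).1 hH⟩
  have : NeZero (Nat.card (RRBG.MaxSubgroup (RRBG.oneIdem S)) : k) :=
    ⟨mt (ringChar.spec k _).1 hG⟩
  have : FiniteDimensional k U := RRBG.finiteDimensional_of_isSimpleModule k e.1 U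
  have : FiniteDimensional k V := RRBG.finiteDimensional_of_isSimpleModule k (RRBG.oneIdem S) V
  have := RRBG.finiteDimensional_linearMap (k := k) (V := V) (N := RRBG.TensorM k e U)
    (R := (MonoidAlgebra k (RRBG.MaxSubgroup (RRBG.oneIdem S)))ᵐᵒᵖ)
  obtain ⟨j, hj⟩ := RRBG.exists_isInflation_tilde_one (k := k) (S := S) V
  refine ⟨_, RRBG.isCompositionMultiplicity_finrank_linearMap (k := k), ?_⟩
  rw [RRBG.rank_ext_one_tilde hj, Module.finrank_eq_rank]

theorem theorem5p14 {k S : Type u} [Field k] [IsAlgClosed k]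
    [Monoid S] [Finite S] [RRBG.IsRRBG S]
    (hchar : ∀ f : RRBG.Idem S, ¬ ringChar k ∣ Nat.card (RRBG.MaxSubgroup f))
    (e : RRBG.MinIdem S)
    (U : Type u) [AddCommGroup U] [Module k U]
    [Module (MonoidAlgebra k (RRBG.MaxSubgroup e.1))ᵐᵒᵖ U]
    [IsScalarTower k (MonoidAlgebra k (RRBG.MaxSubgroup e.1))ᵐᵒᵖ U]
    [IsSimpleModule (MonoidAlgebra k (RRBG.MaxSubgroup e.1))ᵐᵒᵖ U]
    (V : Type u) [AddCommGroup V] [Module k V]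
    [Module (MonoidAlgebra k (RRBG.MaxSubgroup (RRBG.oneIdem S)))ᵐᵒᵖ V]
    [IsScalarTower k (MonoidAlgebra k (RRBG.MaxSubgroup (RRBG.oneIdem S)))ᵐᵒᵖ V]
    [IsSimpleModule (MonoidAlgebra k (RRBG.MaxSubgroup (RRBG.oneIdem S)))ᵐᵒᵖ V] :
    ∃ m : ℕ,
      RRBG.IsCompositionMultiplicity
        (MonoidAlgebra k (RRBG.MaxSubgroup (RRBG.oneIdem S)))ᵐᵒᵖ V
        (RRBG.BalancedTensor k (B := MonoidAlgebra k (RRBG.MaxSubgroup e.1))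
          (MonoidAlgebra k (RRBG.MaxSubgroup (RRBG.oneIdem S))) U (RRBG.BimodM k e)) m ∧
      Module.rank k
        (CategoryTheory.Abelian.Ext
          (ModuleCat.of (MonoidAlgebra k S)ᵐᵒᵖ (RRBG.Tilde k e.1 U))
          (ModuleCat.of (MonoidAlgebra k S)ᵐᵒᵖ (RRBG.Tilde k (RRBG.oneIdem S) V)) 1) = m := by
  exact theorem5p14_general e (hchar e.1) (hchar (RRBG.oneIdem S)) U V
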